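/- Let $\mathbb D$ be the open unit disc, $\mathbb T$ the unit circle, and $m$ the normalized Lebesgue measure on $\mathbb T$. Let $\mu$ be a positive Borel measure on $\mathbb D$ with $\int_{\mathbb D}(1-|w|^2)\,d\mu(w)<\infty$, and put $$V_\mu(z)=\int_{\mathbb D}\frac{(1-|z|^2)(1-|w|^2)}{|1-z\bar w|^2}\,d\mu(w)\quad(z\in\mathbb D),\qquad A_\mu(\zeta,\lambda)=\int_{\mathbb D}\frac{1-|z|^2}{|\zeta-z|^2}\cdot\frac{1-|z|^2}{|\lambda-z|^2}\,d\mu(z)\quad(\zeta,\lambda\in\mathbb T).$$ Let $\mathcal D^h_\mu$ be the space of all $f\in L^2(\mathbb T)$ with $\mathcal D^h_\mu(f):=\int_{\mathbb T}\int_{\mathbb T}|f(\zeta)-f(\lambda)|^2A_\mu(\zeta,\lambda)\,dm(\zeta)\,dm(\lambda)<\infty$, with $\|f\|^2_{\mathcal D^h_\mu}=\|f\|^2_{L^2(\mathbb T)}+\mathcal D^h_\mu(f)$, and for $E\subset\mathbb T$ let $$c_\mu(E)=\inf\{\|f\|^2_{\mathcal D^h_\mu}: f\in\mathcal D^h_\mu,\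 |f|\ge 1\ m\text{-a.e. on a neighbourhood of }E\}.$$ Then, for every $\zeta\in\mathbb T$, $c_\mu(\{\zeta\})=0$ if and only if $$\int_0^1\frac{dr}{(1-r)V_\mu(r\zeta)+(1-r)^2}=\infty.$$ -/

import Mathlib

open MeasureTheory
open scoped ENNReal ComplexConjugate

noncomputable section

namespace DirichletCapacity

/-- The open unit disc, with its Borel sigma-algebra as a subtype of `ℂ`. -/
abbrev Disc : Type := Metric.ball (0 : ℂ) 1

/-- The circle carries its Borel sigma-algebra. -/
instance instMeasurableSpaceCircle : MeasurableSpace Circle := borel Circle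

instance instBorelSpaceCircle : BorelSpace Circle := ⟨rfl⟩

/-- Normalized Lebesgue measure `m` on the unit circle: the image under `t ↦ e^{it}` of
`dt / 2π` on `(-π, π]`. -/
def circleMeasure : Measure Circle :=
  (ENNReal.ofReal (2 * Real.pi))⁻¹ •
    (volume.restrict (Set.Ioc (-Real.pi) Real.pi)).map Circle.exp

/-- The condition `∫_𝔻 (1 - |w|²) dμ(w) < ∞`. -/
def RieszFinite (μ : Measure Disc) : Prop :=
  ∫⁻ w : Disc, ENNReal.ofReal (1 - ‖(w : ℂ)‖ ^ 2) ∂μ < ∞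

/-- `V_μ(z) = ∫_𝔻 (1 - |z|²)(1 - |w|²) / |1 - z w̄|² dμ(w)`, used only for `|z| < 1`. -/
def V (μ : Measure Disc) (z : ℂ) : ℝ≥0∞ :=
  ∫⁻ w : Disc, ENNReal.ofReal
    ((1 - ‖z‖ ^ 2) * (1 - ‖(w : ℂ)‖ ^ 2) / ‖1 - z * conj (w : ℂ)‖ ^ 2) ∂μ

/-- `A_μ(ζ, ξ) = ∫_𝔻 (1 - |z|²)/|ζ - z|² · (1 - |z|²)/|ξ - z|² dμ(z)`. -/
def A (μ : Measure Disc) (ζ ξ : Circle) : ℝ≥0∞ :=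
  ∫⁻ z : Disc, ENNReal.ofReal
    ((1 - ‖(z : ℂ)‖ ^ 2) / ‖(ζ : ℂ) - (z : ℂ)‖ ^ 2 *
      ((1 - ‖(z : ℂ)‖ ^ 2) / ‖(ξ : ℂ) - (z : ℂ)‖ ^ 2)) ∂μ

/-- The Dirichlet integral
`∫_𝕋 ∫_𝕋 |f(ζ) - f(ξ)|² A_μ(ζ, ξ) dm(ζ) dm(ξ)`, with values in `[0, ∞]`. -/
def energy (μ : Measure Disc) (f : Circle → ℂ) : ℝ≥0∞ :=
  ∫⁻ ξ, ∫⁻ ζ, ‖f ζ - f ξ‖ₑ ^ 2 * A μ ζ ξ ∂circleMeasure ∂circleMeasure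

/-- `f` represents an element of the harmonic Dirichlet space: `f ∈ L²(𝕋)` and its Dirichlet
integral is finite. -/
def MemHarmonicDirichlet (μ : Measure Disc) (f : Circle → ℂ) : Prop :=
  MemLp f 2 circleMeasure ∧ energy μ f < ∞

/-- The squared norm of the harmonic Dirichlet space. -/
def normSq (μ : Measure Disc) (f : Circle → ℂ) : ℝ≥0∞ :=
  ∫⁻ ζ, ‖f ζ‖ₑ ^ 2 ∂circleMeasure + energy μ f

/-- The capacity `c_μ(E)`: the infimum of the squared norms of the elements `f` of the harmonic
Dirichlet space with `|f| ≥ 1` almost everywhere on a neighbourhood of `E`. -/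
def capacity (μ : Measure Disc) (E : Set Circle) : ℝ≥0∞ :=
  sInf {c | ∃ f : Circle → ℂ, MemHarmonicDirichlet μ f ∧
    (∃ U : Set Circle, IsOpen U ∧ E ⊆ U ∧ ∀ᵐ ζ ∂circleMeasure, ζ ∈ U → 1 ≤ ‖f ζ‖) ∧
    c = normSq μ f}

end DirichletCapacity

end

noncomputable section

namespace DirichletCapacity

open Set Function

/-! ### The measure on the circle -/

/-! Put M(t) = 1 + ∫ (1-|w|²)/(t+|ζ-w|)² dμ(w) (`radialMass`). Since |1-(1-t)ζw̄| is comparable to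
t+|ζ-w|, the denominator in the criterion at r = 1-t is comparable to t²M(t). Cutting (0,1) at the
points 1-4⁻ᵏ therefore turns divergence of the integral into divergence of S = ∑ 4ᵏ/M(4⁻ᵏ), the
series of `capTerm` (`lintegral_inv_weight_eq_top_iff`). It remains to see that the capacity of {ζ}
vanishes exactly when S = ∞. Both directions start from the fact that A_μ integrates a product of
two Poisson kernels, so the energy is an integral over w ∈ 𝔻 of the mean of |f(ξ)-f(η)|² with ξ, η
independent of law P_w (`energy_eq_lintegral_poisson`).

If S < ∞, let |F| ≥ 1 near ζ and follow F through the points ζ·exp(iθ4⁻ᵏ). Telescoping and weighted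
Cauchy–Schwarz give 1 ≲ |F|² at the outer point plus S times the sum of 4⁻ᵏM(4⁻ᵏ)|increment|²
(`one_le_telescope`). After averaging over θ this sum is controlled by the norm of F
(`sum_radialMass_increment_le`), whence a positive lower bound for the capacity.

If S = ∞, combinations of the Szegő kernels at the points (1-4⁻ᵏ)ζ serve as test functions. These
kernels are almost orthogonal in L² (`lintegral_sum_kern_le`), and a difference quotient of such a
combination is again one, so the same estimate controls the energy (`normSq_kernSum_le`). Optimal
coefficients give capacity at most a constant over each partial sum of S
(`capacity_singleton_le_div`). -/

theorem measurable_circle_coe : Measurable fun ξ : Circle => (ξ : ℂ) :=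
  (by fun_prop : Continuous fun ξ : Circle => (ξ : ℂ)).measurable

theorem lintegral_circleMeasure {G : Circle → ℝ≥0∞} (hG : Measurable G) :
    ∫⁻ ξ, G ξ ∂circleMeasure =
      (ENNReal.ofReal (2 * Real.pi))⁻¹ *
        ∫⁻ θ in Ioc (-Real.pi) Real.pi, G (Circle.exp θ) := by
  rw [circleMeasure, lintegral_smul_measure, smul_eq_mul,
    lintegral_map hG Circle.exp.continuous.measurable]

/-- Both intervals are fundamental domains for translation by multiples of T. No integrability is
needed, which suits integrals that may be infinite. -/
theorem setLIntegral_Ioc_eq_of_periodic {T : ℝ} (hT : 0 < T) {g : ℝ → ℝ≥0∞}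
    (hg : Periodic g T) (s t : ℝ) :
    ∫⁻ x in Ioc s (s + T), g x = ∫⁻ x in Ioc t (t + T), g x := by
  have : VAddInvariantMeasure (AddSubgroup.zmultiples T) ℝ volume :=
    ⟨fun c s _ => measure_preimage_add _ _ _⟩
  apply IsAddFundamentalDomain.setLIntegral_eq (G := AddSubgroup.zmultiples T)
  exacts [isAddFundamentalDomain_Ioc hT s, isAddFundamentalDomain_Ioc hT t,
    hg.map_vadd_zmultiples]

theorem setLIntegral_arc_le (ζ : Circle) {G : Circle → ℝ≥0∞} (hG : Measurable G) :
    ∫⁻ θ in Ioc (0 : ℝ) 1, G (ζ * Circle.exp θ) ≤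
      ENNReal.ofReal (2 * Real.pi) * ∫⁻ ξ, G ξ ∂circleMeasure := by
  have hpi : 0 < 2 * Real.pi := Real.two_pi_pos
  have hper : Periodic (fun θ => G (ζ * Circle.exp θ)) (2 * Real.pi) := fun θ => by
    simp only [Circle.periodic_exp θ]
  rw [lintegral_circleMeasure hG, ← mul_assoc, ENNReal.mul_inv_cancel (by simpa using hpi)
    ENNReal.ofReal_ne_top, one_mul]
  obtain ⟨a, rfl⟩ : ∃ a : ℝ, Circle.exp a = ζ := ⟨_, Circle.exp_arg ζ⟩
  calc ∫⁻ θ in Ioc (0 : ℝ) 1, G (Circle.exp a * Circle.exp θ)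
      ≤ ∫⁻ θ in Ioc (0 : ℝ) (0 + 2 * Real.pi), G (Circle.exp a * Circle.exp θ) :=
        lintegral_mono_set (Ioc_subset_Ioc le_rfl (by linarith [Real.pi_gt_three]))
    _ = ∫⁻ θ in Ioc (-Real.pi - a) (-Real.pi - a + 2 * Real.pi),
          G (Circle.exp a * Circle.exp θ) := setLIntegral_Ioc_eq_of_periodic hpi hper _ _
    _ = ∫⁻ θ in Ioc (-Real.pi) Real.pi, G (Circle.exp θ) := by
        rw [← (measurePreserving_add_left volume a).setLIntegral_comp_preimage_emb
          (measurableEmbedding_addLeft a) (fun θ => G (Circle.exp θ)) (Ioc (-Real.pi) Real.pi)]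
        simp only [Set.preimage_const_add_Ioc, Circle.exp_add]
        congr 3
        ring

theorem integral_circleMeasure {f : Circle → ℂ} (hf : Continuous f) :
    ∫ ξ, f ξ ∂circleMeasure =
      ((2 * Real.pi : ℝ) : ℂ)⁻¹ * ∫ θ in (0 : ℝ)..2 * Real.pi, f (Circle.exp θ) := by
  have hper : Periodic (fun θ => f (Circle.exp θ)) (2 * Real.pi) := fun θ => by
    simp only [Circle.periodic_exp θ]
  have h := hper.intervalIntegral_add_eq 0 (-Real.pi)
  rw [zero_add, show -Real.pi + 2 * Real.pi = Real.pi by ring] at h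
  rw [h, intervalIntegral.integral_of_le (by linarith [Real.pi_pos]), circleMeasure,
    integral_smul_measure, integral_map Circle.exp.continuous.aemeasurable
      hf.aestronglyMeasurable, ENNReal.toReal_inv, ENNReal.toReal_ofReal Real.two_pi_pos.le,
    Complex.real_smul, Complex.ofReal_inv]

instance isProbabilityMeasure_circleMeasure : IsProbabilityMeasure circleMeasure := ⟨by
  have h := lintegral_circleMeasure (G := fun _ => 1) measurable_const
  rw [lintegral_const, one_mul, lintegral_const, one_mul, Measure.restrict_apply MeasurableSet.univ,
    univ_inter, Real.volume_Ioc, show Real.pi - -Real.pi = 2 * Real.pi by ring,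
    ENNReal.inv_mul_cancel (by simpa using Real.pi_pos)
      ENNReal.ofReal_ne_top] at h
  exact h⟩

theorem one_sub_mul_ne_zero {a z : ℂ} (ha : ‖a‖ < 1) (hz : ‖z‖ ≤ 1) : 1 - a * z ≠ 0 := by
  intro h
  have : ‖a * z‖ < 1 := by
    rw [norm_mul]
    nlinarith [norm_nonneg a, norm_nonneg z]
  rw [← sub_eq_zero.1 h, norm_one] at this
  exact lt_irrefl _ this

/-- The reproducing property of the Szegő kernel. -/
theorem integral_szego_mul_conj {a b : ℂ} (ha : ‖a‖ < 1) (hb : ‖b‖ < 1) :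
    ∫ ξ : Circle, (1 - conj a * ξ)⁻¹ * conj ((1 - conj b * (ξ : ℂ))⁻¹) ∂circleMeasure =
      (1 - conj a * b)⁻¹ := by
  have hne : ∀ {c : ℂ}, ‖c‖ < 1 → ∀ ξ : Circle, 1 - conj c * (ξ : ℂ) ≠ 0 := fun hc ξ =>
    one_sub_mul_ne_zero (by simpa using hc) (Circle.norm_coe ξ).le
  have hcont : ∀ {c : ℂ}, ‖c‖ < 1 → Continuous fun ξ : Circle => (1 - conj c * (ξ : ℂ))⁻¹ :=
    fun hc => Continuous.inv₀ (by fun_prop) (hne hc)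
  have hprod : Continuous fun ξ : Circle =>
      (1 - conj a * (ξ : ℂ))⁻¹ * conj ((1 - conj b * (ξ : ℂ))⁻¹) :=
    (hcont ha).mul (Complex.continuous_conj.comp (hcont hb))
  rw [integral_circleMeasure hprod]
  have hd : DifferentiableOn ℂ (fun z => (1 - conj a * z)⁻¹) (Metric.closedBall 0 1) := by
    intro z hz
    have : 1 - conj a * z ≠ 0 := one_sub_mul_ne_zero (by simpa using ha) (by simpa using hz)
    exact DifferentiableAt.differentiableWithinAt (by fun_prop (disch := assumption))
  have h := hd.circleIntegral_sub_inv_smul (w := b) (by simpa using hb)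
  simp only [circleIntegral, deriv_circleMap, smul_eq_mul] at h
  -- On the circle the conjugate of 1 - b̄ξ is (ξ-b)/ξ, so the integrand becomes the Cauchy kernel
  -- at b applied to the function (1-āz)⁻¹.
  have key : ∀ θ : ℝ, circleMap 0 1 θ * Complex.I *
      ((circleMap 0 1 θ - b)⁻¹ * (1 - conj a * circleMap 0 1 θ)⁻¹) =
      Complex.I * ((1 - conj a * (Circle.exp θ : ℂ))⁻¹ *
        conj ((1 - conj b * (Circle.exp θ : ℂ))⁻¹)) := by
    intro θ
    have h1 : circleMap 0 1 θ = (Circle.exp θ : ℂ) := by simp [circleMap, Circle.coe_exp]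
    have h2 : conj (1 - conj b * (Circle.exp θ : ℂ)) =
        ((Circle.exp θ : ℂ) - b) / (Circle.exp θ : ℂ) := by
      rw [map_sub, map_mul, Complex.conj_conj, map_one, ← Circle.coe_inv_eq_conj, Circle.coe_inv]
      field_simp
    rw [h1, map_inv₀, h2, inv_div]
    ring
  simp only [key, intervalIntegral.integral_const_mul] at h
  have hpi : ((2 * Real.pi : ℝ) : ℂ) ≠ 0 := Complex.ofReal_ne_zero.2 Real.two_pi_pos.ne'
  rw [inv_mul_eq_iff_eq_mul₀ hpi]
  refine mul_left_cancel₀ Complex.I_ne_zero (h.trans ?_)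
  push_cast
  ring

/-! ### The Poisson kernel -/

/-- The Poisson kernel of the disc. -/
def poisson (w : Disc) (ξ : Circle) : ℝ≥0∞ :=
  ENNReal.ofReal ((1 - ‖(w : ℂ)‖ ^ 2) / ‖(ξ : ℂ) - (w : ℂ)‖ ^ 2)

theorem norm_disc_lt_one (w : Disc) : ‖(w : ℂ)‖ < 1 := mem_ball_zero_iff.1 w.2

theorem one_sub_norm_sq_pos (w : Disc) : 0 < 1 - ‖(w : ℂ)‖ ^ 2 := by
  nlinarith [norm_disc_lt_one w, norm_nonneg (w : ℂ)]

theorem circle_sub_disc_ne_zero (ξ : Circle) (w : Disc) : (ξ : ℂ) - w ≠ 0 := fun h => by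
  have := norm_disc_lt_one w
  rw [← sub_eq_zero.1 h, Circle.norm_coe] at this
  exact lt_irrefl _ this

theorem norm_one_sub_conj_mul (ξ : Circle) (w : ℂ) : ‖1 - conj w * (ξ : ℂ)‖ = ‖(ξ : ℂ) - w‖ := by
  rw [← Complex.norm_conj, map_sub, map_mul, Complex.conj_conj, map_one, ← Circle.coe_inv_eq_conj,
    Circle.coe_inv]
  have : 1 - w * (ξ : ℂ)⁻¹ = ((ξ : ℂ) - w) * (ξ : ℂ)⁻¹ := by field_simp
  rw [this, norm_mul, norm_inv, Circle.norm_coe, inv_one, mul_one]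

theorem measurable_poisson : Measurable fun p : Disc × Circle => poisson p.1 p.2 := by
  have : Measurable fun p : Disc × Circle => ((p.2 : Circle) : ℂ) :=
    measurable_circle_coe.comp measurable_snd
  have h2 : Measurable fun p : Disc × Circle => ((p.1 : Disc) : ℂ) :=
    measurable_subtype_coe.comp measurable_fst
  unfold poisson
  fun_prop

theorem lintegral_poisson (w : Disc) : ∫⁻ ξ, poisson w ξ ∂circleMeasure = 1 := by
  have hw := norm_disc_lt_one w
  have h := integral_szego_mul_conj hw hw
  simp only [Complex.mul_conj, Complex.normSq_eq_norm_sq, norm_inv, norm_one_sub_conj_mul] at h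
  rw [mul_comm, Complex.mul_conj, Complex.normSq_eq_norm_sq] at h
  have h' : ∫ ξ : Circle, (‖(ξ : ℂ) - w‖⁻¹) ^ 2 ∂circleMeasure = (1 - ‖(w : ℂ)‖ ^ 2)⁻¹ := by
    have h2 := (integral_ofReal (𝕜 := ℂ) (μ := circleMeasure)
      (f := fun ξ : Circle => (‖(ξ : ℂ) - w‖⁻¹) ^ 2)).symm.trans h
    apply Complex.ofReal_injective
    rw [Complex.ofReal_inv, Complex.ofReal_sub, Complex.ofReal_one]
    exact h2
  have hpos := one_sub_norm_sq_pos w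
  -- A Bochner integral with a nonzero value cannot come from a non-integrable function.
  have hint : Integrable (fun ξ : Circle => (‖(ξ : ℂ) - w‖⁻¹) ^ 2) circleMeasure := by
    by_contra hcon
    rw [integral_undef hcon] at h'
    exact (inv_pos.2 hpos).ne h'
  calc ∫⁻ ξ, poisson w ξ ∂circleMeasure
      = ∫⁻ ξ : Circle, ENNReal.ofReal (1 - ‖(w : ℂ)‖ ^ 2) *
          ENNReal.ofReal ((‖(ξ : ℂ) - w‖⁻¹) ^ 2) ∂circleMeasure := by
        refine lintegral_congr fun ξ => ?_
        rw [poisson, ← ENNReal.ofReal_mul hpos.le, inv_pow, div_eq_mul_inv]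
    _ = 1 := by
        rw [lintegral_const_mul' _ _ ENNReal.ofReal_ne_top,
          ← ofReal_integral_eq_lintegral_ofReal hint (ae_of_all _ fun _ => by positivity), h',
          ← ENNReal.ofReal_mul hpos.le, mul_inv_cancel₀ hpos.ne', ENNReal.ofReal_one]

/-! ### The energy as an integral over the disc -/

/-- The measure (1-|w|²)dμ is finite and its density is positive and finite, so it can be inverted.
Tonelli's theorem in the energy formula relies on this. -/
theorem RieszFinite.sigmaFinite {μ : Measure Disc} (hμ : RieszFinite μ) : SigmaFinite μ := by
  set h : Disc → ℝ≥0∞ := fun w => ENNReal.ofReal (1 - ‖(w : ℂ)‖ ^ 2) with hh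
  have hm : Measurable h := by
    have : Measurable fun w : Disc => (w : ℂ) := measurable_subtype_coe
    fun_prop
  have h0 : ∀ w, h w ≠ 0 := fun w => by simpa [hh] using one_sub_norm_sq_pos w
  have : IsFiniteMeasure (μ.withDensity h) := isFiniteMeasure_withDensity hμ.ne
  rw [← withDensity_inv_same hm (ae_of_all μ h0) (ae_of_all μ fun w => ENNReal.ofReal_ne_top)]
  exact SigmaFinite.withDensity_of_ne_top (ae_of_all _ fun w => ENNReal.inv_ne_top.2 (h0 w))

theorem A_eq_lintegral_poisson (μ : Measure Disc) (ζ ξ : Circle) :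
    A μ ζ ξ = ∫⁻ w, poisson w ζ * poisson w ξ ∂μ := by
  refine lintegral_congr fun w => ?_
  rw [poisson, poisson, ENNReal.ofReal_mul]
  exact div_nonneg (one_sub_norm_sq_pos w).le (by positivity)

theorem energy_eq_lintegral_poisson {μ : Measure Disc} [SFinite μ] {f : Circle → ℂ}
    (hf : Measurable f) :
    energy μ f = ∫⁻ w, ∫⁻ ξ, (∫⁻ ζ, ‖f ζ - f ξ‖ₑ ^ 2 * poisson w ζ ∂circleMeasure) *
      poisson w ξ ∂circleMeasure ∂μ := by
  have hP : Measurable fun p : Disc × Circle => poisson p.1 p.2 := measurable_poisson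
  have hjoint : Measurable fun p : (Circle × Disc) × Circle =>
      ‖f p.2 - f p.1.1‖ₑ ^ 2 * (poisson p.1.2 p.2 * poisson p.1.2 p.1.1) := by
    have h1 := hP.comp (f := fun p : (Circle × Disc) × Circle => (p.1.2, p.2)) (by fun_prop)
    have h2 := hP.comp (f := fun p : (Circle × Disc) × Circle => (p.1.2, p.1.1)) (by fun_prop)
    exact (by fun_prop : Measurable fun p : (Circle × Disc) × Circle =>
      ‖f p.2 - f p.1.1‖ₑ ^ 2).mul (h1.mul h2)
  have hswap : Measurable fun p : Circle × Disc =>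
      ∫⁻ ζ, ‖f ζ - f p.1‖ₑ ^ 2 * (poisson p.2 ζ * poisson p.2 p.1) ∂circleMeasure :=
    hjoint.lintegral_prod_right'
  calc energy μ f = ∫⁻ ξ, ∫⁻ w, ∫⁻ ζ, ‖f ζ - f ξ‖ₑ ^ 2 * (poisson w ζ * poisson w ξ)
        ∂circleMeasure ∂μ ∂circleMeasure := by
        refine lintegral_congr fun ξ => ?_
        rw [← lintegral_lintegral_swap]
        · refine lintegral_congr fun ζ => ?_
          rw [A_eq_lintegral_poisson, lintegral_const_mul' _ _ (by simp)]
        · have : Measurable fun p : Circle × Disc => ((ξ, p.2), p.1) := by fun_prop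
          exact (hjoint.comp this).aemeasurable
    _ = ∫⁻ w, ∫⁻ ξ, ∫⁻ ζ, ‖f ζ - f ξ‖ₑ ^ 2 * (poisson w ζ * poisson w ξ)
        ∂circleMeasure ∂circleMeasure ∂μ := lintegral_lintegral_swap hswap.aemeasurable
    _ = _ := by
        refine lintegral_congr fun w => lintegral_congr fun ξ => ?_
        rw [← lintegral_mul_const' _ _ (by simp [poisson])]
        simp only [mul_assoc]

/-! ### Discretization of the integral criterion -/

/-- The function `t ↦ 1 + ∫ (1 - |w|²) / (t + |ζ - w|)² dμ(w)`. -/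
def radialMass (μ : Measure Disc) (ζ : Circle) (t : ℝ) : ℝ≥0∞ :=
  ∫⁻ w : Disc, ENNReal.ofReal ((1 - ‖(w : ℂ)‖ ^ 2) / (t + ‖(ζ : ℂ) - w‖) ^ 2) ∂μ + 1

theorem radialMass_ne_zero (μ : Measure Disc) (ζ : Circle) (t : ℝ) : radialMass μ ζ t ≠ 0 := by
  simp [radialMass]

theorem radialMass_ne_top {μ : Measure Disc} (hμ : RieszFinite μ) (ζ : Circle) {t : ℝ}
    (ht : 0 < t) : radialMass μ ζ t ≠ ∞ := by
  refine ENNReal.add_ne_top.2 ⟨ne_of_lt ?_, ENNReal.one_ne_top⟩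
  calc ∫⁻ w : Disc, ENNReal.ofReal ((1 - ‖(w : ℂ)‖ ^ 2) / (t + ‖(ζ : ℂ) - w‖) ^ 2) ∂μ
      ≤ ∫⁻ w : Disc, ENNReal.ofReal ((t ^ 2)⁻¹) * ENNReal.ofReal (1 - ‖(w : ℂ)‖ ^ 2) ∂μ := by
        refine lintegral_mono fun w => ?_
        rw [← ENNReal.ofReal_mul (by positivity), mul_comm, ← div_eq_mul_inv]
        have := (one_sub_norm_sq_pos w).le
        have := norm_nonneg ((ζ : ℂ) - w)
        gcongr
        linarith
    _ < ∞ := by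
        rw [lintegral_const_mul' _ _ ENNReal.ofReal_ne_top]
        exact ENNReal.mul_lt_top ENNReal.ofReal_lt_top hμ

theorem norm_one_sub_mul_conj_eq (ζ : Circle) (r : ℝ) (w : ℂ) :
    ‖1 - (r : ℂ) * ζ * conj w‖ = ‖(ζ : ℂ) - r * w‖ := by
  rw [← norm_one_sub_conj_mul, map_mul, Complex.conj_ofReal]
  ring_nf

theorem norm_sub_mul_le (ζ : Circle) {t : ℝ} (ht : 0 ≤ t) (w : Disc) :
    ‖(ζ : ℂ) - ((1 - t : ℝ) : ℂ) * w‖ ≤ t + ‖(ζ : ℂ) - w‖ := by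
  have h : (ζ : ℂ) - ((1 - t : ℝ) : ℂ) * w = (t : ℂ) * w + (ζ - w) := by push_cast; ring
  rw [h]
  refine (norm_add_le _ _).trans ?_
  rw [norm_mul, Complex.norm_real, Real.norm_of_nonneg ht]
  nlinarith [norm_disc_lt_one w]

/-- The right-hand norm is at least t because |(1-t)w| ≤ 1-t, and it differs from |ζ-w| by at most
t. Together with the opposite bound `norm_sub_mul_le`, this lets t+|ζ-w| replace the denominator of
V. -/
theorem add_norm_sub_le (ζ : Circle) {t : ℝ} (ht : 0 ≤ t) (ht1 : t ≤ 1) (w : Disc) :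
    t + ‖(ζ : ℂ) - w‖ ≤ 3 * ‖(ζ : ℂ) - ((1 - t : ℝ) : ℂ) * w‖ := by
  have hw := norm_disc_lt_one w
  have h1 : t ≤ ‖(ζ : ℂ) - ((1 - t : ℝ) : ℂ) * w‖ := by
    have h := norm_sub_norm_le (ζ : ℂ) (((1 - t : ℝ) : ℂ) * w)
    rw [norm_mul, Complex.norm_real, Real.norm_of_nonneg (by linarith), Circle.norm_coe] at h
    nlinarith
  have h2 : ‖(ζ : ℂ) - w‖ ≤ ‖(ζ : ℂ) - ((1 - t : ℝ) : ℂ) * w‖ + t := by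
    have h : (ζ : ℂ) - w = (ζ - ((1 - t : ℝ) : ℂ) * w) + -((t : ℂ) * w) := by push_cast; ring
    rw [h]
    refine (norm_add_le _ _).trans ?_
    rw [norm_neg, norm_mul, Complex.norm_real, Real.norm_of_nonneg ht]
    nlinarith
  linarith

theorem norm_sub_mul_pos (ζ : Circle) {t : ℝ} (ht : 0 < t) (ht1 : t ≤ 1) (w : Disc) :
    0 < ‖(ζ : ℂ) - ((1 - t : ℝ) : ℂ) * w‖ := by
  linarith [add_norm_sub_le ζ ht.le ht1 w, norm_nonneg ((ζ : ℂ) - w)]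

theorem radialMass_le_weight (μ : Measure Disc) (ζ : Circle) {c t : ℝ} (hc : 0 < c) (hc1 : c ≤ 1)
    (ht : c / 4 ≤ t) (htc : t ≤ c) :
    ENNReal.ofReal (c ^ 2 / 16) * radialMass μ ζ c ≤
      ENNReal.ofReal t * V μ (((1 - t : ℝ) : ℂ) * ζ) + ENNReal.ofReal (t ^ 2) := by
  have ht0 : 0 < t := by linarith
  rw [radialMass, mul_add, mul_one]
  refine add_le_add ?_ (ENNReal.ofReal_le_ofReal (by nlinarith))
  · rw [V, ← lintegral_const_mul' _ _ ENNReal.ofReal_ne_top,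
      ← lintegral_const_mul' _ _ ENNReal.ofReal_ne_top]
    refine lintegral_mono fun w => ?_
    rw [← ENNReal.ofReal_mul (by positivity), ← ENNReal.ofReal_mul ht0.le]
    apply ENNReal.ofReal_le_ofReal
    rw [norm_one_sub_mul_conj_eq, norm_mul, Complex.norm_real, Circle.norm_coe, mul_one,
      Real.norm_of_nonneg (by linarith)]
    have hh := one_sub_norm_sq_pos w
    have hD := norm_sub_mul_pos ζ ht0 (htc.trans hc1) w
    have hle := norm_sub_mul_le ζ ht0.le w
    have hle' : ‖(ζ : ℂ) - ((1 - t : ℝ) : ℂ) * w‖ ≤ c + ‖(ζ : ℂ) - w‖ := by linarith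
    calc c ^ 2 / 16 * ((1 - ‖(w : ℂ)‖ ^ 2) / (c + ‖(ζ : ℂ) - w‖) ^ 2)
        ≤ (t * (1 - (1 - t) ^ 2)) *
          ((1 - ‖(w : ℂ)‖ ^ 2) / ‖(ζ : ℂ) - ((1 - t : ℝ) : ℂ) * w‖ ^ 2) := by
          -- Here 1-(1-t)² = t(2-t) ≥ t, so the product is at least t² ≥ (c/4)².
          have h1 : c ^ 2 / 16 ≤ t * (1 - (1 - t) ^ 2) := by
            have h2 : t ≤ 1 - (1 - t) ^ 2 := by nlinarith
            nlinarith
          have h3 : 0 ≤ t * (1 - (1 - t) ^ 2) := le_trans (by positivity) h1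
          gcongr
      _ = _ := by ring

theorem weight_le_radialMass (μ : Measure Disc) (ζ : Circle) {c t : ℝ} (hc : 0 < c) (hc1 : c ≤ 1)
    (ht : c / 4 ≤ t) (htc : t ≤ c) :
    ENNReal.ofReal t * V μ (((1 - t : ℝ) : ℂ) * ζ) + ENNReal.ofReal (t ^ 2) ≤
      ENNReal.ofReal (288 * c ^ 2) * radialMass μ ζ c := by
  have ht0 : 0 < t := by linarith
  rw [radialMass, mul_add, mul_one]
  refine add_le_add ?_ (ENNReal.ofReal_le_ofReal (by nlinarith))
  · rw [V, ← lintegral_const_mul' _ _ ENNReal.ofReal_ne_top,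
      ← lintegral_const_mul' _ _ ENNReal.ofReal_ne_top]
    refine lintegral_mono fun w => ?_
    rw [← ENNReal.ofReal_mul ht0.le, ← ENNReal.ofReal_mul (by positivity)]
    apply ENNReal.ofReal_le_ofReal
    rw [norm_one_sub_mul_conj_eq, norm_mul, Complex.norm_real, Circle.norm_coe, mul_one,
      Real.norm_of_nonneg (by linarith)]
    have hh := one_sub_norm_sq_pos w
    have hδ := norm_nonneg ((ζ : ℂ) - w)
    have hle := add_norm_sub_le ζ ht0.le (htc.trans hc1) w
    -- The 12 is 4 · 3, from c ≤ 4t and `add_norm_sub_le`. Together with t(1-(1-t)²) ≤ 2c² it gives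
    -- the constant 2 · 12² = 288.
    have hle' : (c + ‖(ζ : ℂ) - w‖) / 12 ≤ ‖(ζ : ℂ) - ((1 - t : ℝ) : ℂ) * w‖ := by linarith
    calc t * ((1 - (1 - t) ^ 2) * (1 - ‖(w : ℂ)‖ ^ 2) / ‖(ζ : ℂ) - ((1 - t : ℝ) : ℂ) * w‖ ^ 2)
        = (t * (1 - (1 - t) ^ 2)) *
          ((1 - ‖(w : ℂ)‖ ^ 2) / ‖(ζ : ℂ) - ((1 - t : ℝ) : ℂ) * w‖ ^ 2) := by ring
      _ ≤ (2 * c ^ 2) * ((1 - ‖(w : ℂ)‖ ^ 2) / ((c + ‖(ζ : ℂ) - w‖) / 12) ^ 2) := by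
          have h1 : t * (1 - (1 - t) ^ 2) ≤ 2 * c ^ 2 := by
            nlinarith [pow_pos ht0 3, mul_self_le_mul_self ht0.le htc]
          exact mul_le_mul h1 (by gcongr) (by positivity) (by positivity)
      _ = _ := by field_simp; norm_num

/-- The scales `4⁻ᵏ`. -/
def scale (k : ℕ) : ℝ := (1 / 4) ^ k

theorem scale_pos (k : ℕ) : 0 < scale k := by unfold scale; positivity

theorem scale_le_one (k : ℕ) : scale k ≤ 1 := pow_le_one₀ (by norm_num) (by norm_num)

theorem scale_succ (k : ℕ) : scale (k + 1) = scale k / 4 := by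
  rw [scale, scale, pow_succ]; ring

theorem scale_zero : scale 0 = 1 := pow_zero _

theorem antitone_scale : Antitone scale := antitone_nat_of_succ_le fun k => by
  rw [scale_succ]; linarith [scale_pos k]

/-- The terms of the series whose divergence characterizes points of capacity zero. -/
def capTerm (μ : Measure Disc) (ζ : Circle) (k : ℕ) : ℝ≥0∞ :=
  ENNReal.ofReal (scale k)⁻¹ * (radialMass μ ζ (scale k))⁻¹

theorem capTerm_ne_top {μ : Measure Disc} (ζ : Circle) (k : ℕ) : capTerm μ ζ k ≠ ∞ :=
  ENNReal.mul_ne_top ENNReal.ofReal_ne_top (ENNReal.inv_ne_top.2 (radialMass_ne_zero μ ζ _))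

theorem lintegral_eq_tsum_scale (g : ℝ → ℝ≥0∞) :
    ∫⁻ r in Ioo (0 : ℝ) 1, g r =
      ∑' k, ∫⁻ r in Ico (1 - scale k) (1 - scale (k + 1)), g r := by
  have hmono : Monotone fun k => 1 - scale k := fun i j h => by
    have := antitone_scale h
    simp only; linarith
  have hdisj : Pairwise (Disjoint on fun k => Ico (1 - scale k) (1 - scale (k + 1))) :=
    hmono.pairwise_disjoint_on_Ico_succ
  rw [← lintegral_iUnion (fun _ => measurableSet_Ico) hdisj, setLIntegral_congr Ioo_ae_eq_Ico]
  congr 2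
  ext r
  simp only [mem_Ico, mem_iUnion]
  constructor
  · rintro ⟨h0, h1⟩
    obtain ⟨n, hn, hn'⟩ := exists_nat_pow_near_of_lt_one (x := 1 - r) (y := 1 / 4) (by linarith)
      (by linarith) (by norm_num) (by norm_num)
    refine ⟨n, ?_, ?_⟩ <;> unfold scale <;> linarith
  · rintro ⟨k, h0, h1⟩
    exact ⟨by linarith [scale_le_one k], by linarith [scale_pos (k + 1)]⟩

theorem lintegral_inv_weight_eq_top_iff (μ : Measure Disc) (ζ : Circle) :
    ∫⁻ r in Ioo (0 : ℝ) 1, (ENNReal.ofReal (1 - r) * V μ ((r : ℂ) * (ζ : ℂ))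
      + ENNReal.ofReal ((1 - r) ^ 2))⁻¹ = ∞ ↔ ∑' k, capTerm μ ζ k = ∞ := by
  set g : ℝ → ℝ≥0∞ := fun r => (ENNReal.ofReal (1 - r) * V μ ((r : ℂ) * (ζ : ℂ))
      + ENNReal.ofReal ((1 - r) ^ 2))⁻¹ with hg
  have hvol : ∀ k, volume (Ico (1 - scale k) (1 - scale (k + 1))) =
      ENNReal.ofReal (3 / 4 * scale k) := fun k => by
    rw [Real.volume_Ico, scale_succ]; congr 1; ring
  have hinv : ∀ {a : ℝ}, 0 < a → ∀ x : ℝ≥0∞,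
      (ENNReal.ofReal a * x)⁻¹ = ENNReal.ofReal a⁻¹ * x⁻¹ := fun ha x => by
    rw [ENNReal.mul_inv (Or.inl (by simpa using ha)) (Or.inl ENNReal.ofReal_ne_top),
      ENNReal.ofReal_inv_of_pos ha]
  -- Each interval has length (3/4)·4⁻ᵏ, so the constants are 12 = 16 · 3/4 here and 384 = 288 · 4/3
  -- in the reverse bound.
  have hupper : ∀ k, ∫⁻ r in Ico (1 - scale k) (1 - scale (k + 1)), g r ≤ 12 * capTerm μ ζ k := by
    intro k
    have hc := scale_pos k
    calc ∫⁻ r in Ico (1 - scale k) (1 - scale (k + 1)), g r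
        ≤ ∫⁻ _ in Ico (1 - scale k) (1 - scale (k + 1)),
            (ENNReal.ofReal (scale k ^ 2 / 16) * radialMass μ ζ (scale k))⁻¹ := by
          refine setLIntegral_mono' measurableSet_Ico fun r hr => ENNReal.inv_le_inv.2 ?_
          rw [mem_Ico, scale_succ] at hr
          simpa using radialMass_le_weight μ ζ (t := 1 - r) hc (scale_le_one k) (by linarith)
            (by linarith)
      _ = 12 * capTerm μ ζ k := by
          rw [setLIntegral_const, hvol, hinv (by positivity), capTerm, mul_right_comm,
            ← mul_assoc, ← ENNReal.ofReal_mul (by positivity),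
            show (12 : ℝ≥0∞) = ENNReal.ofReal 12 by simp, ← ENNReal.ofReal_mul (by norm_num)]
          congr 2
          field_simp
          norm_num
  have hlower : ∀ k, capTerm μ ζ k ≤
      384 * ∫⁻ r in Ico (1 - scale k) (1 - scale (k + 1)), g r := by
    intro k
    have hc := scale_pos k
    calc capTerm μ ζ k = 384 * ∫⁻ _ in Ico (1 - scale k) (1 - scale (k + 1)),
            (ENNReal.ofReal (288 * scale k ^ 2) * radialMass μ ζ (scale k))⁻¹ := by
          rw [setLIntegral_const, hvol, hinv (by positivity), capTerm, mul_right_comm,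
            ← mul_assoc, ← ENNReal.ofReal_mul (by positivity),
            show (384 : ℝ≥0∞) = ENNReal.ofReal 384 by simp, ← ENNReal.ofReal_mul (by norm_num)]
          congr 2
          field_simp
          norm_num
      _ ≤ _ := by
          gcongr 384 * ?_
          refine setLIntegral_mono' measurableSet_Ico fun r hr => ENNReal.inv_le_inv.2 ?_
          rw [mem_Ico, scale_succ] at hr
          simpa using weight_le_radialMass μ ζ (t := 1 - r) hc (scale_le_one k) (by linarith)
            (by linarith)
  rw [lintegral_eq_tsum_scale]
  constructor
  · intro h
    have h2 := ENNReal.tsum_le_tsum hupper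
    rw [h, top_le_iff, ENNReal.tsum_mul_left] at h2
    by_contra hcon
    exact ENNReal.mul_ne_top (by simp) hcon h2
  · intro h
    have h2 := ENNReal.tsum_le_tsum hlower
    rw [h, top_le_iff, ENNReal.tsum_mul_left] at h2
    by_contra hcon
    exact ENNReal.mul_ne_top (by simp) hcon h2

/-! ### The lower bound for the capacity -/

theorem enorm_sq_eq_ofReal {E : Type*} [SeminormedAddCommGroup E] (x : E) :
    ‖x‖ₑ ^ 2 = ENNReal.ofReal (‖x‖ ^ 2) := by
  rw [← ofReal_norm, ENNReal.ofReal_pow (norm_nonneg _)]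

theorem enorm_sub_sq_le {E : Type*} [SeminormedAddCommGroup E] (x y c : E) :
    ‖x - y‖ₑ ^ 2 ≤ 2 * ‖x - c‖ₑ ^ 2 + 2 * ‖y - c‖ₑ ^ 2 := by
  simp only [enorm_sq_eq_ofReal]
  rw [show (2 : ℝ≥0∞) = ENNReal.ofReal 2 by simp, ← ENNReal.ofReal_mul (by norm_num),
    ← ENNReal.ofReal_mul (by norm_num), ← ENNReal.ofReal_add (by positivity) (by positivity)]
  apply ENNReal.ofReal_le_ofReal
  have h : ‖x - y‖ ≤ ‖x - c‖ + ‖y - c‖ := by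
    simpa [dist_eq_norm] using dist_triangle_right x y c
  nlinarith [sq_nonneg (‖x - c‖ - ‖y - c‖), norm_nonneg (x - y), norm_nonneg (x - c),
    norm_nonneg (y - c)]

theorem ofReal_mul_setLIntegral_comp_mul (G : ℝ → ℝ≥0∞) {c : ℝ} (hc : 0 < c) :
    ENNReal.ofReal c * ∫⁻ θ in Ioc (1 / 4 : ℝ) 1, G (θ * c) = ∫⁻ θ in Ioc (c / 4) c, G θ := by
  have h := lintegral_image_eq_lintegral_abs_deriv_mul (s := Ioc (1 / 4 : ℝ) 1)
    (f := fun θ => θ * c) (f' := fun _ => c) measurableSet_Ioc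
    (fun x _ => by simpa using ((hasDerivAt_id x).mul_const c).hasDerivWithinAt)
    (fun x _ y _ h => mul_right_cancel₀ hc.ne' h) G
  have himage : (fun θ : ℝ => θ * c) '' Ioc (1 / 4 : ℝ) 1 = Ioc (c / 4) c := by
    ext x
    constructor
    · rintro ⟨θ, ⟨h1, h2⟩, rfl⟩
      constructor <;> simp only <;> nlinarith
    · rintro ⟨h1, h2⟩
      refine ⟨x / c, ⟨?_, ?_⟩, by field_simp⟩
      · rw [lt_div_iff₀ hc]; linarith
      · rw [div_le_iff₀ hc]; linarith
  rw [himage, abs_of_pos hc, lintegral_const_mul' _ _ ENNReal.ofReal_ne_top] at h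
  exact h.symm

theorem sum_setLIntegral_scale_le (G : ℝ → ℝ≥0∞) (N : ℕ) :
    ∑ k ∈ Finset.range N, ∫⁻ θ in Ioc (scale (k + 1)) (scale k), G θ ≤
      ∫⁻ θ in Ioc (0 : ℝ) 1, G θ := by
  have hdisj : Pairwise (Disjoint on fun k => Ioc (scale (k + 1)) (scale k)) :=
    antitone_scale.pairwise_disjoint_on_Ioc_succ
  calc ∑ k ∈ Finset.range N, ∫⁻ θ in Ioc (scale (k + 1)) (scale k), G θ
      ≤ ∑' k, ∫⁻ θ in Ioc (scale (k + 1)) (scale k), G θ := ENNReal.sum_le_tsum _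
    _ = ∫⁻ θ in ⋃ k, Ioc (scale (k + 1)) (scale k), G θ :=
        (lintegral_iUnion (fun _ => measurableSet_Ioc) hdisj _).symm
    _ ≤ _ := lintegral_mono_set (iUnion_subset fun k =>
        Ioc_subset_Ioc (scale_pos _).le (scale_le_one k))

theorem measurable_circle_exp : Measurable fun θ : ℝ => Circle.exp θ :=
  Circle.exp.continuous.measurable

/-- The mean square increment of `F` between consecutive arcs approaching `ζ`. -/
def increment (F : Circle → ℂ) (ζ : Circle) (k : ℕ) : ℝ≥0∞ :=
  ∫⁻ θ in Ioc (1 / 4 : ℝ) 1,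
    ‖F (ζ * Circle.exp (θ * scale k)) - F (ζ * Circle.exp (θ * scale (k + 1)))‖ₑ ^ 2

/-- Each increment is split through the constant c, and rescaling θ turns the two halves into
integrals over neighbouring arcs. On both arcs Q is at least q k, and the arcs are disjoint over k,
so each is counted at most twice in the sum. The constant is 10 = 2 + 8, the 8 coming from `scale k
= 4 * scale (k + 1)`. -/
theorem sum_increment_le (ζ : Circle) {F : Circle → ℂ} (hF : Measurable F) (c : ℂ)
    {Q : Circle → ℝ≥0∞} (hQ : Measurable Q) {q : ℕ → ℝ≥0∞}
    (hq : ∀ k θ, 0 < θ → θ ≤ scale k → q k ≤ Q (ζ * Circle.exp θ)) (N : ℕ) :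
    ∑ k ∈ Finset.range N, ENNReal.ofReal (scale k) * q k * increment F ζ k ≤
      10 * (ENNReal.ofReal (2 * Real.pi) * ∫⁻ ξ, ‖F ξ - c‖ₑ ^ 2 * Q ξ ∂circleMeasure) := by
  have hexp := measurable_circle_exp
  set G : ℝ → ℝ≥0∞ := fun θ =>
    ‖F (ζ * Circle.exp θ) - c‖ₑ ^ 2 * Q (ζ * Circle.exp θ) with hG
  set I : ℕ → ℝ≥0∞ := fun k => ∫⁻ θ in Ioc (scale (k + 1)) (scale k), G θ with hI
  have hpiece : ∀ k j, k ≤ j → q k * (ENNReal.ofReal (scale j) *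
      ∫⁻ θ in Ioc (1 / 4 : ℝ) 1, ‖F (ζ * Circle.exp (θ * scale j)) - c‖ₑ ^ 2) ≤ I j := by
    intro k j hkj
    rw [ofReal_mul_setLIntegral_comp_mul (fun θ => ‖F (ζ * Circle.exp θ) - c‖ₑ ^ 2) (scale_pos j),
      ← scale_succ, ← lintegral_const_mul _ (by fun_prop)]
    refine setLIntegral_mono' measurableSet_Ioc fun θ hθ => ?_
    rw [hG, mul_comm]
    simp only
    gcongr
    exact hq k θ ((scale_pos _).trans hθ.1) (hθ.2.trans (antitone_scale hkj))
  have hterm : ∀ k, ENNReal.ofReal (scale k) * q k * increment F ζ k ≤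
      2 * I k + 8 * I (k + 1) := by
    intro k
    have h4 : ENNReal.ofReal (scale k) = 4 * ENNReal.ofReal (scale (k + 1)) := by
      rw [scale_succ, show (4 : ℝ≥0∞) = ENNReal.ofReal 4 by simp,
        ← ENNReal.ofReal_mul (by norm_num)]
      congr 1; ring
    set X : ℕ → ℝ≥0∞ := fun j =>
      ∫⁻ θ in Ioc (1 / 4 : ℝ) 1, ‖F (ζ * Circle.exp (θ * scale j)) - c‖ₑ ^ 2 with hX
    have hinc : increment F ζ k ≤ 2 * X k + 2 * X (k + 1) := by
      rw [hX, ← lintegral_const_mul _ (by fun_prop), ← lintegral_const_mul _ (by fun_prop),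
        ← lintegral_add_left (by fun_prop)]
      exact lintegral_mono fun θ => enorm_sub_sq_le _ _ _
    calc ENNReal.ofReal (scale k) * q k * increment F ζ k
        ≤ ENNReal.ofReal (scale k) * q k * (2 * X k + 2 * X (k + 1)) := by gcongr
      _ = 2 * (q k * (ENNReal.ofReal (scale k) * X k)) +
          2 * (q k * (ENNReal.ofReal (scale k) * X (k + 1))) := by ring
      _ = 2 * (q k * (ENNReal.ofReal (scale k) * X k)) +
          8 * (q k * (ENNReal.ofReal (scale (k + 1)) * X (k + 1))) := by
          nth_rewrite 2 [h4]; ring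
      _ ≤ _ := by
          gcongr
          exacts [hpiece k k le_rfl, hpiece k (k + 1) k.le_succ]
  have hsum := sum_setLIntegral_scale_le G
  have harc : ∫⁻ θ in Ioc (0 : ℝ) 1, G θ ≤
      ENNReal.ofReal (2 * Real.pi) * ∫⁻ ξ, ‖F ξ - c‖ₑ ^ 2 * Q ξ ∂circleMeasure :=
    setLIntegral_arc_le ζ (G := fun ξ => ‖F ξ - c‖ₑ ^ 2 * Q ξ) (by fun_prop)
  calc ∑ k ∈ Finset.range N, ENNReal.ofReal (scale k) * q k * increment F ζ k
      ≤ ∑ k ∈ Finset.range N, (2 * I k + 8 * I (k + 1)) := Finset.sum_le_sum fun k _ => hterm k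
    _ = 2 * ∑ k ∈ Finset.range N, I k + 8 * ∑ k ∈ Finset.range N, I (k + 1) := by
        rw [Finset.sum_add_distrib, Finset.mul_sum, Finset.mul_sum]
    _ ≤ 2 * (∫⁻ θ in Ioc (0 : ℝ) 1, G θ) + 8 * ∫⁻ θ in Ioc (0 : ℝ) 1, G θ := by
        gcongr
        · exact hsum N
        · refine le_trans ?_ (hsum (N + 1))
          rw [Finset.sum_range_succ']
          exact le_self_add
    _ = 10 * ∫⁻ θ in Ioc (0 : ℝ) 1, G θ := by ring
    _ ≤ _ := by gcongr

theorem norm_mul_exp_sub_le (ζ : Circle) {θ : ℝ} (hθ : 0 ≤ θ) :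
    ‖((ζ * Circle.exp θ : Circle) : ℂ) - ζ‖ ≤ θ := by
  have h : ((ζ * Circle.exp θ : Circle) : ℂ) - ζ =
      ζ * (Complex.exp (Complex.I * θ) - 1) := by
    rw [Circle.coe_mul, Circle.coe_exp, mul_comm Complex.I]; ring
  rw [h, norm_mul, Circle.norm_coe, one_mul]
  exact Real.norm_exp_I_mul_ofReal_sub_one_le.trans (Real.norm_of_nonneg hθ).le

/-- For each w, the integrand of the radial mass at scale k is a lower bound for P_w on the arc of
length 4⁻ᵏ at ζ. Thus `sum_increment_le` applies with Q = P_w, and integrating in w produces the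
energy. The summand 1 in the radial mass is paid for by the L² norm. -/
theorem sum_radialMass_increment_le {μ : Measure Disc} [SFinite μ] (ζ : Circle) {F : Circle → ℂ}
    (hF : Measurable F) (N : ℕ) :
    ∑ k ∈ Finset.range N,
        ENNReal.ofReal (scale k) * radialMass μ ζ (scale k) * increment F ζ k ≤
      10 * ENNReal.ofReal (2 * Real.pi) * normSq μ F := by
  have hco : Measurable fun w : Disc => (w : ℂ) := measurable_subtype_coe
  set q : Disc → ℕ → ℝ≥0∞ := fun w k =>
    ENNReal.ofReal ((1 - ‖(w : ℂ)‖ ^ 2) / (scale k + ‖(ζ : ℂ) - w‖) ^ 2) with hqdef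
  have hq : ∀ w k θ, 0 < θ → θ ≤ scale k → q w k ≤ poisson w (ζ * Circle.exp θ) := by
    intro w k θ h0 hθ
    apply ENNReal.ofReal_le_ofReal
    have h1 := norm_mul_exp_sub_le ζ h0.le
    have h2 := norm_pos_iff.2 (circle_sub_disc_ne_zero (ζ * Circle.exp θ) w)
    have h3 : ‖((ζ * Circle.exp θ : Circle) : ℂ) - w‖ ≤ scale k + ‖(ζ : ℂ) - w‖ := by
      have := norm_sub_le_norm_sub_add_norm_sub ((ζ * Circle.exp θ : Circle) : ℂ) ζ (w : ℂ)
      linarith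
    have := (one_sub_norm_sq_pos w).le
    gcongr
  have hP : ∀ w, Measurable (poisson w) := fun w => measurable_poisson.of_uncurry_left
  have hL2 : ∑ k ∈ Finset.range N, ENNReal.ofReal (scale k) * increment F ζ k ≤
      10 * (ENNReal.ofReal (2 * Real.pi) * ∫⁻ ξ, ‖F ξ‖ₑ ^ 2 ∂circleMeasure) := by
    simpa using sum_increment_le ζ hF 0 (Q := fun _ => 1) measurable_const (q := fun _ => 1)
      (fun _ _ _ _ => le_rfl) N
  have hdisc : ∀ w, ∑ k ∈ Finset.range N, ENNReal.ofReal (scale k) * q w k * increment F ζ k ≤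
      10 * ENNReal.ofReal (2 * Real.pi) * ∫⁻ ξ,
        (∫⁻ ζ, ‖F ζ - F ξ‖ₑ ^ 2 * poisson w ζ ∂circleMeasure) * poisson w ξ ∂circleMeasure := by
    intro w
    -- The left side does not depend on ξ, so it may be averaged against the probability P_w; the
    -- constant c is then chosen as F(ξ) separately for each ξ.
    calc ∑ k ∈ Finset.range N, ENNReal.ofReal (scale k) * q w k * increment F ζ k
        = ∫⁻ ξ, (∑ k ∈ Finset.range N, ENNReal.ofReal (scale k) * q w k * increment F ζ k) *
            poisson w ξ ∂circleMeasure := by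
          rw [lintegral_const_mul _ (hP w), lintegral_poisson, mul_one]
      _ ≤ ∫⁻ ξ, 10 * ENNReal.ofReal (2 * Real.pi) *
            ((∫⁻ ζ, ‖F ζ - F ξ‖ₑ ^ 2 * poisson w ζ ∂circleMeasure) * poisson w ξ)
            ∂circleMeasure := by
          refine lintegral_mono fun ξ => ?_
          rw [← mul_assoc]
          refine mul_le_mul_left (le_trans (sum_increment_le ζ hF (F ξ) (hP w) (hq w) N) ?_) _
          rw [mul_assoc]
      _ = _ := lintegral_const_mul' _ _ (ENNReal.mul_ne_top (by simp) ENNReal.ofReal_ne_top)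
  have hen : ∑ k ∈ Finset.range N,
      ENNReal.ofReal (scale k) * (∫⁻ w, q w k ∂μ) * increment F ζ k ≤
      10 * ENNReal.ofReal (2 * Real.pi) * energy μ F := by
    rw [energy_eq_lintegral_poisson hF,
      ← lintegral_const_mul' _ _ (ENNReal.mul_ne_top (by simp) ENNReal.ofReal_ne_top)]
    refine le_trans (le_of_eq ?_) (lintegral_mono hdisc)
    rw [lintegral_finsetSum _ fun k _ => by fun_prop]
    refine Finset.sum_congr rfl fun k _ => ?_
    rw [lintegral_mul_const _ (by fun_prop), lintegral_const_mul _ (by fun_prop)]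
  calc ∑ k ∈ Finset.range N,
        ENNReal.ofReal (scale k) * radialMass μ ζ (scale k) * increment F ζ k
      = ∑ k ∈ Finset.range N, ENNReal.ofReal (scale k) * (∫⁻ w, q w k ∂μ) * increment F ζ k +
        ∑ k ∈ Finset.range N, ENNReal.ofReal (scale k) * increment F ζ k := by
        rw [← Finset.sum_add_distrib]
        refine Finset.sum_congr rfl fun k _ => ?_
        rw [radialMass]; ring
    _ ≤ 10 * ENNReal.ofReal (2 * Real.pi) * energy μ F +
        10 * (ENNReal.ofReal (2 * Real.pi) * ∫⁻ ξ, ‖F ξ‖ₑ ^ 2 ∂circleMeasure) :=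
        add_le_add hen hL2
    _ = _ := by rw [normSq]; ring

/-- Cauchy–Schwarz for the telescoping sum with the weights b k and their inverses. It is applied
with b k = 4⁻ᵏM(4⁻ᵏ), whose inverse is `capTerm`. -/
theorem sq_norm_le_telescope {E : Type*} [SeminormedAddCommGroup E] (x : ℕ → E) {b : ℕ → ℝ}
    (hb : ∀ k, 0 < b k) (N : ℕ) :
    ‖x N‖ ^ 2 ≤ 2 * ‖x 0‖ ^ 2 +
      2 * (∑ k ∈ Finset.range N, (b k)⁻¹) *
        ∑ k ∈ Finset.range N, b k * ‖x k - x (k + 1)‖ ^ 2 := by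
  have h1 : ‖x N‖ ≤ ‖x 0‖ + ∑ k ∈ Finset.range N, ‖x k - x (k + 1)‖ := by
    induction N with
    | zero => simp
    | succ n ih =>
      rw [Finset.sum_range_succ]
      have := norm_le_norm_add_norm_sub' (x (n + 1)) (x n)
      rw [norm_sub_rev] at this
      linarith
  have h2 := Finset.sum_sq_le_sum_mul_sum_of_sq_le_mul (Finset.range N)
    (r := fun k => ‖x k - x (k + 1)‖) (f := fun k => (b k)⁻¹)
    (g := fun k => b k * ‖x k - x (k + 1)‖ ^ 2)
    (fun k _ => (inv_pos.2 (hb k)).le) (fun k _ => mul_nonneg (hb k).le (sq_nonneg _))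
    (fun k _ => by rw [inv_mul_cancel_left₀ (hb k).ne'])
  have h3 : 0 ≤ ∑ k ∈ Finset.range N, ‖x k - x (k + 1)‖ :=
    Finset.sum_nonneg fun _ _ => norm_nonneg _
  nlinarith [sq_nonneg (‖x 0‖ - ∑ k ∈ Finset.range N, ‖x k - x (k + 1)‖), norm_nonneg (x N),
    norm_nonneg (x 0), mul_self_le_mul_self (norm_nonneg _) h1]

theorem one_le_telescope {μ : Measure Disc} (hμ : RieszFinite μ) (ζ : Circle) (x : ℕ → ℂ) {N : ℕ}
    (hN : 1 ≤ ‖x N‖) :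
    1 ≤ 2 * ‖x 0‖ₑ ^ 2 + 2 * (∑' k, capTerm μ ζ k) *
      ∑ k ∈ Finset.range N,
        ENNReal.ofReal (scale k) * radialMass μ ζ (scale k) * ‖x k - x (k + 1)‖ₑ ^ 2 := by
  have hM0 : ∀ k, 0 < (radialMass μ ζ (scale k)).toReal := fun k =>
    ENNReal.toReal_pos (radialMass_ne_zero μ ζ _) (radialMass_ne_top hμ ζ (scale_pos k))
  set b : ℕ → ℝ := fun k => scale k * (radialMass μ ζ (scale k)).toReal with hbdef
  have hb : ∀ k, 0 < b k := fun k => mul_pos (scale_pos k) (hM0 k)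
  have hβ : ∀ k, ENNReal.ofReal (scale k) * radialMass μ ζ (scale k) = ENNReal.ofReal (b k) :=
    fun k => by
      rw [hbdef, ENNReal.ofReal_mul (scale_pos k).le,
        ENNReal.ofReal_toReal (radialMass_ne_top hμ ζ (scale_pos k))]
  have hcap : ∀ k, capTerm μ ζ k = ENNReal.ofReal (b k)⁻¹ := fun k => by
    rw [capTerm, hbdef, mul_inv, ENNReal.ofReal_mul (inv_pos.2 (scale_pos k)).le,
      ENNReal.ofReal_inv_of_pos (hM0 k),
      ENNReal.ofReal_toReal (radialMass_ne_top hμ ζ (scale_pos k))]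
  have h := sq_norm_le_telescope x hb N
  have h1 : (1 : ℝ) ≤ ‖x N‖ ^ 2 := by nlinarith
  have hs1 : 0 ≤ ∑ k ∈ Finset.range N, (b k)⁻¹ :=
    Finset.sum_nonneg fun k _ => (inv_pos.2 (hb k)).le
  have hs2 : 0 ≤ ∑ k ∈ Finset.range N, b k * ‖x k - x (k + 1)‖ ^ 2 :=
    Finset.sum_nonneg fun k _ => mul_nonneg (hb k).le (sq_nonneg _)
  have h2 : (2 : ℝ≥0∞) = ENNReal.ofReal 2 := by simp
  calc (1 : ℝ≥0∞) ≤ ENNReal.ofReal (2 * ‖x 0‖ ^ 2 + 2 * (∑ k ∈ Finset.range N, (b k)⁻¹) *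
        ∑ k ∈ Finset.range N, b k * ‖x k - x (k + 1)‖ ^ 2) := by
        rw [← ENNReal.ofReal_one]
        exact ENNReal.ofReal_le_ofReal (h1.trans h)
    _ = 2 * ‖x 0‖ₑ ^ 2 + 2 * (∑ k ∈ Finset.range N, capTerm μ ζ k) *
      ∑ k ∈ Finset.range N,
        ENNReal.ofReal (scale k) * radialMass μ ζ (scale k) * ‖x k - x (k + 1)‖ₑ ^ 2 := by
        rw [ENNReal.ofReal_add (by positivity) (by positivity), ENNReal.ofReal_mul (by positivity),
          ENNReal.ofReal_mul (by positivity), ENNReal.ofReal_mul (by positivity), ← h2,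
          ENNReal.ofReal_sum_of_nonneg fun k _ => (inv_pos.2 (hb k)).le,
          ENNReal.ofReal_sum_of_nonneg fun k _ => mul_nonneg (hb k).le (sq_nonneg _)]
        simp only [hcap, hβ, enorm_sq_eq_ofReal, ENNReal.ofReal_mul (hb _).le]
    _ ≤ _ := by
        gcongr
        exact ENNReal.sum_le_tsum _

theorem three_quarters_le_normSq {μ : Measure Disc} (hμ : RieszFinite μ) (ζ : Circle)
    {F : Circle → ℂ} (hF : Measurable F) {U : Set Circle} (hU : IsOpen U) (hζ : ζ ∈ U)
    (hFU : ∀ ξ ∈ U, 1 ≤ ‖F ξ‖) :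
    ENNReal.ofReal (3 / 4) ≤
      2 * ENNReal.ofReal (2 * Real.pi) * (1 + 10 * ∑' k, capTerm μ ζ k) * normSq μ F := by
  have := hμ.sigmaFinite
  have hexp := measurable_circle_exp
  -- N depends on U, but the final bound does not, since the partial sum of `capTerm` has been
  -- replaced by the whole series.
  obtain ⟨N, hN⟩ : ∃ N, ∀ θ ∈ Ioc (1 / 4 : ℝ) 1, ζ * Circle.exp (θ * scale N) ∈ U := by
    obtain ⟨ε, hε, hball⟩ := Metric.isOpen_iff.1 hU ζ hζ
    obtain ⟨N, hN⟩ := exists_pow_lt_of_lt_one hε (by norm_num : (1 / 4 : ℝ) < 1)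
    refine ⟨N, fun θ hθ => hball ?_⟩
    have hs := scale_pos N
    have h0 : 0 ≤ θ * scale N := mul_nonneg (by linarith [hθ.1]) hs.le
    have h1 : θ * scale N ≤ scale N := mul_le_of_le_one_left hs.le hθ.2
    have h2 := norm_mul_exp_sub_le ζ h0
    rw [Metric.mem_ball]
    change dist ((ζ * Circle.exp (θ * scale N) : Circle) : ℂ) (ζ : ℂ) < ε
    rw [dist_eq_norm]
    exact (h2.trans h1).trans_lt hN
  have hx0 : ∫⁻ θ in Ioc (1 / 4 : ℝ) 1, ‖F (ζ * Circle.exp (θ * scale 0))‖ₑ ^ 2 ≤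
      ENNReal.ofReal (2 * Real.pi) * normSq μ F := by
    simp only [scale_zero, mul_one]
    calc ∫⁻ θ in Ioc (1 / 4 : ℝ) 1, ‖F (ζ * Circle.exp θ)‖ₑ ^ 2
        ≤ ∫⁻ θ in Ioc (0 : ℝ) 1, ‖F (ζ * Circle.exp θ)‖ₑ ^ 2 :=
          lintegral_mono_set (Ioc_subset_Ioc (by norm_num) le_rfl)
      _ ≤ ENNReal.ofReal (2 * Real.pi) * ∫⁻ ξ, ‖F ξ‖ₑ ^ 2 ∂circleMeasure :=
          setLIntegral_arc_le ζ (G := fun ξ => ‖F ξ‖ₑ ^ 2) (by fun_prop)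
      _ ≤ _ := by gcongr; exact le_self_add
  set S := ∑' k, capTerm μ ζ k with hS
  calc ENNReal.ofReal (3 / 4) = ∫⁻ _ in Ioc (1 / 4 : ℝ) 1, (1 : ℝ≥0∞) := by
        rw [setLIntegral_const, one_mul, Real.volume_Ioc]; norm_num
    _ ≤ ∫⁻ θ in Ioc (1 / 4 : ℝ) 1, (2 * ‖F (ζ * Circle.exp (θ * scale 0))‖ₑ ^ 2 + 2 * S *
          ∑ k ∈ Finset.range N, ENNReal.ofReal (scale k) * radialMass μ ζ (scale k) *
            ‖F (ζ * Circle.exp (θ * scale k)) - F (ζ * Circle.exp (θ * scale (k + 1)))‖ₑ ^ 2) :=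
        setLIntegral_mono' measurableSet_Ioc fun θ hθ =>
          one_le_telescope hμ ζ (fun k => F (ζ * Circle.exp (θ * scale k)))
            (hFU _ (hN θ hθ))
    _ = 2 * (∫⁻ θ in Ioc (1 / 4 : ℝ) 1, ‖F (ζ * Circle.exp (θ * scale 0))‖ₑ ^ 2) + 2 * S *
          ∑ k ∈ Finset.range N, ENNReal.ofReal (scale k) * radialMass μ ζ (scale k) *
            increment F ζ k := by
        rw [lintegral_add_left (by fun_prop), lintegral_const_mul _ (by fun_prop),
          lintegral_const_mul _ (by fun_prop), lintegral_finsetSum _ fun k _ => by fun_prop]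
        simp only [increment]
        congr 2
        refine Finset.sum_congr rfl fun k _ => ?_
        rw [lintegral_const_mul _ (by fun_prop)]
    _ ≤ 2 * (ENNReal.ofReal (2 * Real.pi) * normSq μ F) +
          2 * S * (10 * ENNReal.ofReal (2 * Real.pi) * normSq μ F) := by
        gcongr
        exact sum_radialMass_increment_le ζ hF N
    _ = _ := by ring

theorem normSq_congr_ae (μ : Measure Disc) {f g : Circle → ℂ} (h : f =ᵐ[circleMeasure] g) :
    normSq μ f = normSq μ g := by
  rw [normSq, normSq, energy, energy]
  congr 1
  · exact lintegral_congr_ae (h.mono fun ξ hξ => by simp only [hξ])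
  · refine lintegral_congr_ae (h.mono fun ξ hξ => ?_)
    exact lintegral_congr_ae (h.mono fun η hη => by simp only [hξ, hη])

theorem capacity_singleton_ne_zero {μ : Measure Disc} (hμ : RieszFinite μ) (ζ : Circle)
    (hS : ∑' k, capTerm μ ζ k ≠ ∞) : capacity μ {ζ} ≠ 0 := by
  set K : ℝ≥0∞ := 2 * ENNReal.ofReal (2 * Real.pi) * (1 + 10 * ∑' k, capTerm μ ζ k) with hK
  have hKtop : K ≠ ∞ := by
    refine ENNReal.mul_ne_top (ENNReal.mul_ne_top (by simp) ENNReal.ofReal_ne_top) ?_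
    exact ENNReal.add_ne_top.2 ⟨by simp, ENNReal.mul_ne_top (by simp) hS⟩
  have hle : ENNReal.ofReal (3 / 4) / K ≤ capacity μ {ζ} := by
    refine le_sInf ?_
    rintro c ⟨f, hf, ⟨U, hU, hζU, hfU⟩, rfl⟩
    obtain ⟨g, hg, hfg⟩ := hf.1.1
    have hgm : Measurable g := hg.measurable
    -- B is null. Redefining g as 1 there gives a measurable representative whose modulus is at
    -- least 1 at every point of U, so it can be sampled along each sequence of points.
    set B : Set Circle := U ∩ {ξ | ‖g ξ‖ < 1} with hB
    have hBm : MeasurableSet B :=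
      hU.measurableSet.inter (measurableSet_lt hgm.norm measurable_const)
    classical
    set F : Circle → ℂ := B.piecewise (fun _ => 1) g with hFdef
    have hF : Measurable F := Measurable.piecewise hBm measurable_const hgm
    have hfF : f =ᵐ[circleMeasure] F := by
      filter_upwards [hfg, hfU] with ξ h1 h2
      have : ξ ∉ B := fun hξ => absurd (h2 hξ.1) (by rw [h1]; exact not_le.2 hξ.2)
      rw [hFdef, piecewise_eq_of_notMem _ _ _ this, h1]
    have hFU : ∀ ξ ∈ U, 1 ≤ ‖F ξ‖ := by
      intro ξ hξ
      by_cases hb : ξ ∈ B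
      · rw [hFdef, piecewise_eq_of_mem _ _ _ hb, norm_one]
      · rw [hFdef, piecewise_eq_of_notMem _ _ _ hb]
        exact not_lt.1 fun h => hb ⟨hξ, h⟩
    rw [normSq_congr_ae μ hfF]
    exact ENNReal.div_le_of_le_mul' (three_quarters_le_normSq hμ ζ hF hU (hζU rfl) hFU)
  intro h0
  rw [h0, nonpos_iff_eq_zero, ENNReal.div_eq_zero_iff] at hle
  rcases hle with h | h
  · norm_num at h
  · exact hKtop h

/-! ### The upper bound for the capacity -/

/-- The exponent is |j-k| written with truncated subtraction. The right side is the exact value of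
the full series over k, which makes the induction on j close. -/
theorem sum_half_pow_dist_le (j N : ℕ) :
    ∑ k ∈ Finset.range N, (1 / 2 : ℝ) ^ ((j - k) + (k - j)) ≤ 3 - (1 / 2) ^ j := by
  induction j generalizing N with
  | zero =>
    have h := sum_geometric_two_le N
    simp only [Nat.zero_sub, Nat.sub_zero, zero_add, pow_zero]
    linarith
  | succ j ih =>
    cases N with
    | zero =>
      have : (1 / 2 : ℝ) ^ (j + 1) ≤ 1 := pow_le_one₀ (by norm_num) (by norm_num)
      simp only [Finset.range_zero, Finset.sum_empty]
      linarith
    | succ N =>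
      have h := ih N
      rw [Finset.sum_range_succ']
      simp only [Nat.add_sub_add_right, Nat.sub_zero, Nat.zero_sub, add_zero]
      rw [pow_succ]
      linarith

/-- The denominator is at least the larger of the two scales, and 2⁻ʲ is the square root of `scale
j`. So the normalized Gram matrix of the kernels decays geometrically off the diagonal. -/
theorem half_pow_mul_div_le (j k : ℕ) :
    (1 / 2 : ℝ) ^ j * (1 / 2) ^ k / (1 - (1 - scale j) * (1 - scale k)) ≤
      (1 / 2) ^ ((j - k) + (k - j)) := by
  wlog hjk : j ≤ k generalizing j k
  · have := this k j (by omega)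
    rwa [mul_comm ((1 / 2 : ℝ) ^ k), mul_comm (1 - scale k), add_comm (k - j)] at this
  obtain ⟨d, rfl⟩ := Nat.exists_eq_add_of_le hjk
  have hj := scale_pos j
  have hk := scale_pos (j + d)
  have hj1 := scale_le_one j
  have hle : scale j ≤ 1 - (1 - scale j) * (1 - scale (j + d)) := by nlinarith
  rw [div_le_iff₀ (by linarith), show (j - (j + d)) + (j + d - j) = d by omega, pow_add]
  have hs : scale j = (1 / 2) ^ j * (1 / 2) ^ j := by
    rw [scale, ← mul_pow]; norm_num
  have hd : (0 : ℝ) < (1 / 2) ^ d := by positivity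
  calc (1 / 2 : ℝ) ^ j * ((1 / 2) ^ j * (1 / 2) ^ d) = (1 / 2) ^ d * scale j := by rw [hs]; ring
    _ ≤ _ := by gcongr

/-- Schur's test: after dividing α k by the square root of `scale k`, the matrix is symmetric and
dominated by one with row sums at most 3. -/
theorem sum_mul_div_one_sub_le (α : ℕ → ℝ) (N : ℕ) :
    ∑ j ∈ Finset.range N, ∑ k ∈ Finset.range N,
      |α j| * |α k| / (1 - (1 - scale j) * (1 - scale k)) ≤
      3 * ∑ k ∈ Finset.range N, α k ^ 2 / scale k := by
  have hs : ∀ k, scale k = ((1 / 2) ^ k) ^ 2 := fun k => by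
    rw [scale, ← pow_mul, mul_comm, pow_mul]; norm_num
  set b : ℕ → ℝ := fun k => |α k| / (1 / 2) ^ k with hb
  set ρ : ℕ → ℕ → ℝ := fun j k => (1 / 2) ^ ((j - k) + (k - j)) with hρ
  have hb2 : ∀ k, b k ^ 2 = α k ^ 2 / scale k := fun k => by rw [hb, div_pow, sq_abs, hs]
  have hterm : ∀ j k, |α j| * |α k| / (1 - (1 - scale j) * (1 - scale k)) ≤
      (b j ^ 2 / 2) * ρ j k + (b k ^ 2 / 2) * ρ k j := by
    intro j k
    have hb0 : 0 ≤ b j * b k := by positivity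
    have hρ0 : 0 ≤ ρ j k := by positivity
    have hsymm : ρ k j = ρ j k := by simp only [hρ, add_comm]
    calc |α j| * |α k| / (1 - (1 - scale j) * (1 - scale k))
        = b j * b k *
          ((1 / 2 : ℝ) ^ j * (1 / 2) ^ k / (1 - (1 - scale j) * (1 - scale k))) := by
          rw [hb]; field_simp
      _ ≤ b j * b k * ρ j k := by gcongr; exact half_pow_mul_div_le j k
      _ ≤ _ := by
          rw [hsymm]
          nlinarith [mul_nonneg (sq_nonneg (b j - b k)) hρ0]
  have hrow : ∀ j, ∑ k ∈ Finset.range N, (b j ^ 2 / 2) * ρ j k ≤ 3 / 2 * b j ^ 2 := by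
    intro j
    have h := sum_half_pow_dist_le j N
    have h0 : (0 : ℝ) ≤ (1 / 2) ^ j := by positivity
    rw [← Finset.mul_sum]
    nlinarith [sq_nonneg (b j)]
  calc ∑ j ∈ Finset.range N, ∑ k ∈ Finset.range N,
        |α j| * |α k| / (1 - (1 - scale j) * (1 - scale k))
      ≤ ∑ j ∈ Finset.range N, ∑ k ∈ Finset.range N,
        ((b j ^ 2 / 2) * ρ j k + (b k ^ 2 / 2) * ρ k j) :=
        Finset.sum_le_sum fun j _ => Finset.sum_le_sum fun k _ => hterm j k
    _ = ∑ j ∈ Finset.range N, ∑ k ∈ Finset.range N, (b j ^ 2 / 2) * ρ j k +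
        ∑ k ∈ Finset.range N, ∑ j ∈ Finset.range N, (b k ^ 2 / 2) * ρ k j := by
        simp only [Finset.sum_add_distrib]
        congr 1
        exact Finset.sum_comm
    _ ≤ ∑ j ∈ Finset.range N, 3 / 2 * b j ^ 2 + ∑ k ∈ Finset.range N, 3 / 2 * b k ^ 2 :=
        add_le_add (Finset.sum_le_sum fun j _ => hrow j) (Finset.sum_le_sum fun j _ => hrow j)
    _ = _ := by
        rw [← Finset.sum_add_distrib, Finset.mul_sum]
        refine Finset.sum_congr rfl fun k _ => ?_
        rw [← hb2]; ring

/-- The Szegő kernel at the point `(1 - 4⁻ᵏ) ζ`. -/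
def kern (ζ : Circle) (k : ℕ) (z : ℂ) : ℂ :=
  (1 - conj (((1 - scale k : ℝ) : ℂ) * ζ) * z)⁻¹

theorem norm_pole_lt_one (ζ : Circle) (k : ℕ) : ‖((1 - scale k : ℝ) : ℂ) * ζ‖ < 1 := by
  rw [norm_mul, Complex.norm_real, Circle.norm_coe, mul_one,
    Real.norm_of_nonneg (by linarith [scale_le_one k])]
  linarith [scale_pos k]

theorem kern_denom_ne_zero (ζ : Circle) (k : ℕ) {z : ℂ} (hz : ‖z‖ ≤ 1) :
    1 - conj (((1 - scale k : ℝ) : ℂ) * ζ) * z ≠ 0 :=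
  one_sub_mul_ne_zero (by rw [Complex.norm_conj]; exact norm_pole_lt_one ζ k) hz

theorem continuous_kern (ζ : Circle) (k : ℕ) : Continuous fun ξ : Circle => kern ζ k ξ :=
  Continuous.inv₀ (by fun_prop) fun ξ => kern_denom_ne_zero ζ k (Circle.norm_coe ξ).le

theorem conj_mul_self_circle (ζ : Circle) : conj (ζ : ℂ) * ζ = 1 := by
  rw [← Circle.coe_inv_eq_conj, Circle.coe_inv, inv_mul_cancel₀ (Circle.coe_ne_zero ζ)]

theorem kern_self (ζ : Circle) (k : ℕ) : kern ζ k ζ = ((scale k)⁻¹ : ℝ) := by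
  rw [kern, map_mul, Complex.conj_ofReal, mul_assoc, conj_mul_self_circle]
  push_cast
  ring

theorem integral_kern_mul_conj (ζ : Circle) (j k : ℕ) :
    ∫ ξ : Circle, kern ζ j ξ * conj (kern ζ k ξ) ∂circleMeasure =
      ((1 - (1 - scale j) * (1 - scale k))⁻¹ : ℝ) := by
  have h := integral_szego_mul_conj (norm_pole_lt_one ζ j) (norm_pole_lt_one ζ k)
  refine h.trans ?_
  rw [map_mul, Complex.conj_ofReal, mul_mul_mul_comm, conj_mul_self_circle]
  push_cast
  ring

theorem norm_kern_le (ζ : Circle) (k : ℕ) (w : Disc) :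
    ‖kern ζ k w‖ ≤ 3 / (scale k + ‖(ζ : ℂ) - w‖) := by
  have h1 : ‖1 - conj (((1 - scale k : ℝ) : ℂ) * ζ) * (w : ℂ)‖ =
      ‖(ζ : ℂ) - ((1 - scale k : ℝ) : ℂ) * w‖ := by
    rw [← norm_one_sub_mul_conj_eq, ← Complex.norm_conj]
    simp only [map_sub, map_mul, map_one, Complex.conj_conj]
  have h2 := add_norm_sub_le ζ (scale_pos k).le (scale_le_one k) w
  have h3 : 0 < scale k + ‖(ζ : ℂ) - w‖ := by linarith [scale_pos k, norm_nonneg ((ζ : ℂ) - w)]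
  rw [kern, norm_inv, h1, inv_le_comm₀ (by linarith) (by positivity), inv_div]
  linarith

/-- The kernels at the points `(1 - 4⁻ᵏ) ζ` are almost orthogonal. -/
theorem lintegral_sum_kern_le (ζ : Circle) (a : ℕ → ℂ) (N : ℕ) :
    ∫⁻ ξ : Circle, ‖∑ k ∈ Finset.range N, a k * kern ζ k ξ‖ₑ ^ 2 ∂circleMeasure ≤
      3 * ∑ k ∈ Finset.range N, ENNReal.ofReal (‖a k‖ ^ 2 / scale k) := by
  set f : Circle → ℂ := fun ξ => ∑ k ∈ Finset.range N, a k * kern ζ k ξ with hf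
  have hint : ∀ {g : Circle → ℂ}, Continuous g → Integrable g circleMeasure := fun hg =>
    hg.integrable_of_hasCompactSupport (HasCompactSupport.of_compactSpace _)
  have hk := continuous_kern ζ
  have hfc : Continuous f := continuous_finsetSum _ fun k _ => continuous_const.mul (hk k)
  have hintR : Integrable (fun ξ => ‖f ξ‖ ^ 2) circleMeasure :=
    (hfc.norm.pow 2).integrable_of_hasCompactSupport (HasCompactSupport.of_compactSpace _)
  have hpair : ∀ j k, Continuous fun ξ : Circle => kern ζ j ξ * conj (kern ζ k ξ) := fun j k =>
    (hk j).mul (Complex.continuous_conj.comp (hk k))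
  have hval : ((∫ ξ, ‖f ξ‖ ^ 2 ∂circleMeasure : ℝ) : ℂ) =
      ∑ j ∈ Finset.range N, ∑ k ∈ Finset.range N,
        a j * conj (a k) * ((1 - (1 - scale j) * (1 - scale k))⁻¹ : ℝ) := by
    have h1 : ((∫ ξ, ‖f ξ‖ ^ 2 ∂circleMeasure : ℝ) : ℂ) =
        ∫ ξ, ((‖f ξ‖ ^ 2 : ℝ) : ℂ) ∂circleMeasure := integral_ofReal.symm
    have h2 : ∀ ξ, ((‖f ξ‖ ^ 2 : ℝ) : ℂ) = ∑ j ∈ Finset.range N, ∑ k ∈ Finset.range N,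
        a j * conj (a k) * (kern ζ j ξ * conj (kern ζ k ξ)) := by
      intro ξ
      rw [← Complex.normSq_eq_norm_sq, ← Complex.mul_conj, hf, map_sum, Finset.sum_mul_sum]
      refine Finset.sum_congr rfl fun j _ => Finset.sum_congr rfl fun k _ => ?_
      rw [map_mul]; ring
    rw [h1]
    simp only [h2]
    rw [integral_finsetSum _ fun j _ => integrable_finsetSum _ fun k _ =>
      (hint (hpair j k)).const_mul _]
    refine Finset.sum_congr rfl fun j _ => ?_
    rw [integral_finsetSum _ fun k _ => (hint (hpair j k)).const_mul _]
    refine Finset.sum_congr rfl fun k _ => ?_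
    rw [integral_const_mul, integral_kern_mul_conj]
  have hbound : ∫ ξ, ‖f ξ‖ ^ 2 ∂circleMeasure ≤
      3 * ∑ k ∈ Finset.range N, ‖a k‖ ^ 2 / scale k := by
    refine le_trans ?_ (sum_mul_div_one_sub_le (fun k => ‖a k‖) N)
    have h0 : 0 ≤ ∫ ξ, ‖f ξ‖ ^ 2 ∂circleMeasure := integral_nonneg fun _ => by positivity
    calc ∫ ξ, ‖f ξ‖ ^ 2 ∂circleMeasure
        = ‖((∫ ξ, ‖f ξ‖ ^ 2 ∂circleMeasure : ℝ) : ℂ)‖ := by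
          rw [Complex.norm_real, Real.norm_of_nonneg h0]
      _ ≤ _ := by
          rw [hval]
          refine (norm_sum_le _ _).trans (Finset.sum_le_sum fun j _ =>
            (norm_sum_le _ _).trans (Finset.sum_le_sum fun k _ => le_of_eq ?_))
          have hden : 0 ≤ 1 - (1 - scale j) * (1 - scale k) := by
            nlinarith [scale_pos j, scale_pos k, scale_le_one j, scale_le_one k]
          rw [norm_mul, norm_mul, Complex.norm_conj, Complex.norm_real,
            Real.norm_of_nonneg (inv_nonneg.2 hden), abs_norm, abs_norm, div_eq_mul_inv]
  have hnn : ∀ k, 0 ≤ ‖a k‖ ^ 2 / scale k := fun k => div_nonneg (sq_nonneg _) (scale_pos k).le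
  calc ∫⁻ ξ, ‖f ξ‖ₑ ^ 2 ∂circleMeasure = ENNReal.ofReal (∫ ξ, ‖f ξ‖ ^ 2 ∂circleMeasure) := by
        rw [ofReal_integral_eq_lintegral_ofReal hintR (ae_of_all _ fun _ => by positivity)]
        simp only [enorm_sq_eq_ofReal]
    _ ≤ ENNReal.ofReal (3 * ∑ k ∈ Finset.range N, ‖a k‖ ^ 2 / scale k) :=
        ENNReal.ofReal_le_ofReal hbound
    _ = _ := by
        rw [ENNReal.ofReal_mul (by norm_num), ENNReal.ofReal_sum_of_nonneg fun k _ => hnn k]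
        simp

/-- The factor z - w is what cancels the denominator of the Poisson kernel. -/
theorem kern_sub_kern (ζ : Circle) (k : ℕ) {z w : ℂ} (hz : ‖z‖ ≤ 1) (hw : ‖w‖ ≤ 1) :
    kern ζ k z - kern ζ k w =
      (z - w) * (conj (((1 - scale k : ℝ) : ℂ) * ζ) * kern ζ k w * kern ζ k z) := by
  have h1 := kern_denom_ne_zero ζ k hz
  have h2 := kern_denom_ne_zero ζ k hw
  unfold kern
  generalize conj (((1 - scale k : ℝ) : ℂ) * ζ) = a at *
  field_simp
  ring

/-- Linear combinations of the kernels, used as test functions. -/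
def kernSum (ζ : Circle) (c : ℕ → ℝ) (N : ℕ) (z : ℂ) : ℂ :=
  ∑ k ∈ Finset.range N, (c k : ℂ) * kern ζ k z

theorem continuous_kernSum (ζ : Circle) (c : ℕ → ℝ) (N : ℕ) :
    Continuous fun ξ : Circle => kernSum ζ c N ξ :=
  continuous_finsetSum _ fun k _ => continuous_const.mul (continuous_kern ζ k)

/-- Since |ξ-w|²P_w(ξ) = 1-|w|², the integral is 1-|w|² times the squared L² norm of a new
combination of the same kernels, with coefficients multiplied by values at w. Almost orthogonality
gives a factor 3 and `norm_kern_le` a factor 3², hence 27. -/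
theorem lintegral_kernSum_sub_le (ζ : Circle) (c : ℕ → ℝ) (N : ℕ) (w : Disc) :
    ∫⁻ ξ : Circle, ‖kernSum ζ c N ξ - kernSum ζ c N w‖ₑ ^ 2 * poisson w ξ ∂circleMeasure ≤
      27 * ∑ k ∈ Finset.range N, ENNReal.ofReal (c k ^ 2 / scale k) *
        ENNReal.ofReal ((1 - ‖(w : ℂ)‖ ^ 2) / (scale k + ‖(ζ : ℂ) - w‖) ^ 2) := by
  have hh := one_sub_norm_sq_pos w
  set a : ℕ → ℂ := fun k => c k * (conj (((1 - scale k : ℝ) : ℂ) * ζ) * kern ζ k w) with ha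
  have hpt : ∀ ξ : Circle, ‖kernSum ζ c N ξ - kernSum ζ c N w‖ₑ ^ 2 * poisson w ξ =
      ENNReal.ofReal (1 - ‖(w : ℂ)‖ ^ 2) *
        ‖∑ k ∈ Finset.range N, a k * kern ζ k ξ‖ₑ ^ 2 := by
    intro ξ
    have h1 : kernSum ζ c N ξ - kernSum ζ c N w =
        ((ξ : ℂ) - w) * ∑ k ∈ Finset.range N, a k * kern ζ k ξ := by
      rw [kernSum, kernSum, ← Finset.sum_sub_distrib, Finset.mul_sum]
      refine Finset.sum_congr rfl fun k _ => ?_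
      rw [← mul_sub, kern_sub_kern ζ k (Circle.norm_coe ξ).le (norm_disc_lt_one w).le, ha]
      ring
    have h2 := norm_pos_iff.2 (circle_sub_disc_ne_zero ξ w)
    rw [h1, enorm_sq_eq_ofReal, enorm_sq_eq_ofReal, poisson, ← ENNReal.ofReal_mul (by positivity),
      ← ENNReal.ofReal_mul hh.le, norm_mul]
    congr 1
    field_simp
  simp only [hpt]
  rw [lintegral_const_mul' _ _ ENNReal.ofReal_ne_top]
  calc ENNReal.ofReal (1 - ‖(w : ℂ)‖ ^ 2) *
        ∫⁻ ξ : Circle, ‖∑ k ∈ Finset.range N, a k * kern ζ k ξ‖ₑ ^ 2 ∂circleMeasure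
      ≤ ENNReal.ofReal (1 - ‖(w : ℂ)‖ ^ 2) *
        (3 * ∑ k ∈ Finset.range N, ENNReal.ofReal (‖a k‖ ^ 2 / scale k)) := by
        gcongr
        exact lintegral_sum_kern_le ζ a N
    _ = 3 * ∑ k ∈ Finset.range N, ENNReal.ofReal (1 - ‖(w : ℂ)‖ ^ 2) *
          ENNReal.ofReal (‖a k‖ ^ 2 / scale k) := by
        rw [← Finset.mul_sum]; ring
    _ ≤ 3 * ∑ k ∈ Finset.range N, 9 * (ENNReal.ofReal (c k ^ 2 / scale k) *
        ENNReal.ofReal ((1 - ‖(w : ℂ)‖ ^ 2) / (scale k + ‖(ζ : ℂ) - w‖) ^ 2)) := by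
        refine mul_le_mul_right (Finset.sum_le_sum fun k _ => ?_) _
        have hs := scale_pos k
        have hak : ‖a k‖ ≤ |c k| * (3 / (scale k + ‖(ζ : ℂ) - w‖)) := by
          rw [ha, norm_mul, norm_mul, Complex.norm_conj, Complex.norm_real, Real.norm_eq_abs]
          gcongr
          refine (mul_le_of_le_one_left (norm_nonneg _) (norm_pole_lt_one ζ k).le).trans
            (norm_kern_le ζ k w)
        rw [← ENNReal.ofReal_mul hh.le, ← ENNReal.ofReal_mul (by positivity),
          show (9 : ℝ≥0∞) = ENNReal.ofReal 9 by simp, ← ENNReal.ofReal_mul (by norm_num)]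
        apply ENNReal.ofReal_le_ofReal
        calc (1 - ‖(w : ℂ)‖ ^ 2) * (‖a k‖ ^ 2 / scale k)
            ≤ (1 - ‖(w : ℂ)‖ ^ 2) *
              ((|c k| * (3 / (scale k + ‖(ζ : ℂ) - w‖))) ^ 2 / scale k) := by gcongr
          _ = _ := by
            rw [mul_pow, sq_abs, div_pow]; ring
    _ = _ := by rw [← Finset.mul_sum]; ring

theorem normSq_kernSum_le {μ : Measure Disc} [SFinite μ] (ζ : Circle) (c : ℕ → ℝ) (N : ℕ) :
    normSq μ (fun ξ => kernSum ζ c N ξ) ≤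
      108 * ∑ k ∈ Finset.range N,
        ENNReal.ofReal (c k ^ 2 / scale k) * radialMass μ ζ (scale k) := by
  have hco : Measurable fun w : Disc => (w : ℂ) := measurable_subtype_coe
  have hP : ∀ w, Measurable (poisson w) := fun w => measurable_poisson.of_uncurry_left
  have hfm : Measurable fun ξ : Circle => kernSum ζ c N ξ := (continuous_kernSum ζ c N).measurable
  set q : Disc → ℕ → ℝ≥0∞ := fun w k =>
    ENNReal.ofReal ((1 - ‖(w : ℂ)‖ ^ 2) / (scale k + ‖(ζ : ℂ) - w‖) ^ 2) with hqdef
  set e : ℕ → ℝ≥0∞ := fun k => ENNReal.ofReal (c k ^ 2 / scale k) with he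
  have hL2 : ∫⁻ ξ : Circle, ‖kernSum ζ c N ξ‖ₑ ^ 2 ∂circleMeasure ≤
      108 * ∑ k ∈ Finset.range N, e k := by
    refine (lintegral_sum_kern_le ζ (fun k => (c k : ℂ)) N).trans ?_
    simp only [Complex.norm_real, Real.norm_eq_abs, sq_abs]
    gcongr
    norm_num
  have hdisc : ∀ w : Disc, ∫⁻ ξ : Circle, (∫⁻ η : Circle,
      ‖kernSum ζ c N η - kernSum ζ c N ξ‖ₑ ^ 2 * poisson w η ∂circleMeasure) *
      poisson w ξ ∂circleMeasure ≤ 108 * ∑ k ∈ Finset.range N, e k * q w k := by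
    intro w
    set D : Circle → ℝ≥0∞ := fun ξ => ‖kernSum ζ c N ξ - kernSum ζ c N w‖ₑ ^ 2 with hD
    have hDm : Measurable D := by fun_prop
    set J : ℝ≥0∞ := ∫⁻ ξ, D ξ * poisson w ξ ∂circleMeasure with hJ
    have hPm := hP w
    -- Comparing both variables with the value at w costs a factor 4 in total, hence 108 = 4 · 27.
    have hinner : ∀ ξ : Circle, ∫⁻ η : Circle,
        ‖kernSum ζ c N η - kernSum ζ c N ξ‖ₑ ^ 2 * poisson w η ∂circleMeasure ≤
        2 * J + 2 * D ξ := by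
      intro ξ
      calc ∫⁻ η : Circle, ‖kernSum ζ c N η - kernSum ζ c N ξ‖ₑ ^ 2 * poisson w η ∂circleMeasure
          ≤ ∫⁻ η, (2 * (D η * poisson w η) + 2 * D ξ * poisson w η) ∂circleMeasure := by
            refine lintegral_mono fun η => ?_
            rw [← mul_assoc, ← add_mul]
            exact mul_le_mul_left (enorm_sub_sq_le _ _ _) _
        _ = _ := by
            rw [lintegral_add_left (by fun_prop), lintegral_const_mul _ (by fun_prop),
              lintegral_const_mul _ hPm, lintegral_poisson, mul_one]
    calc ∫⁻ ξ : Circle, (∫⁻ η : Circle,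
        ‖kernSum ζ c N η - kernSum ζ c N ξ‖ₑ ^ 2 * poisson w η ∂circleMeasure) *
        poisson w ξ ∂circleMeasure
        ≤ ∫⁻ ξ, (2 * J * poisson w ξ + 2 * (D ξ * poisson w ξ)) ∂circleMeasure := by
          refine lintegral_mono fun ξ => ?_
          rw [← mul_assoc, ← add_mul]
          exact mul_le_mul_left (hinner ξ) _
      _ = 4 * J := by
          rw [lintegral_add_left (by fun_prop), lintegral_const_mul _ hPm, lintegral_poisson,
            lintegral_const_mul _ (by fun_prop)]
          ring
      _ ≤ 4 * (27 * ∑ k ∈ Finset.range N, e k * q w k) := by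
          gcongr
          exact lintegral_kernSum_sub_le ζ c N w
      _ = _ := by rw [← mul_assoc]; norm_num
  have hen : energy μ (fun ξ => kernSum ζ c N ξ) ≤
      108 * ∑ k ∈ Finset.range N, e k * ∫⁻ w, q w k ∂μ := by
    rw [energy_eq_lintegral_poisson hfm]
    refine (lintegral_mono hdisc).trans (le_of_eq ?_)
    rw [lintegral_const_mul _ (by fun_prop), lintegral_finsetSum _ fun k _ => by fun_prop]
    congr 1
    refine Finset.sum_congr rfl fun k _ => ?_
    rw [lintegral_const_mul _ (by fun_prop)]
  refine (add_le_add hL2 hen).trans (le_of_eq ?_)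
  rw [← mul_add, ← Finset.sum_add_distrib]
  congr 1
  refine Finset.sum_congr rfl fun k _ => ?_
  rw [radialMass]; ring

theorem capacity_singleton_le_div {μ : Measure Disc} (hμ : RieszFinite μ) (ζ : Circle) (N : ℕ)
    (hN : ∑ k ∈ Finset.range N, capTerm μ ζ k ≠ 0) :
    capacity μ {ζ} ≤ 432 / ∑ k ∈ Finset.range N, capTerm μ ζ k := by
  have := hμ.sigmaFinite
  set S := ∑ k ∈ Finset.range N, capTerm μ ζ k with hS
  have hStop : S ≠ ∞ := ENNReal.sum_ne_top.2 fun k _ => capTerm_ne_top ζ k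
  have hs : 0 < S.toReal := ENNReal.toReal_pos hN hStop
  set M : ℕ → ℝ := fun k => (radialMass μ ζ (scale k)).toReal with hM
  have hM0 : ∀ k, 0 < M k := fun k =>
    ENNReal.toReal_pos (radialMass_ne_zero μ ζ _) (radialMass_ne_top hμ ζ (scale_pos k))
  have hMM : ∀ k, ENNReal.ofReal (M k) = radialMass μ ζ (scale k) := fun k =>
    ENNReal.ofReal_toReal (radialMass_ne_top hμ ζ (scale_pos k))
  have hcap : ∀ k, capTerm μ ζ k = ENNReal.ofReal ((scale k)⁻¹ * (M k)⁻¹) := fun k => by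
    rw [ENNReal.ofReal_mul (inv_pos.2 (scale_pos k)).le, ENNReal.ofReal_inv_of_pos (hM0 k), hMM,
      capTerm]
  have hsum : S.toReal = ∑ k ∈ Finset.range N, (scale k)⁻¹ * (M k)⁻¹ := by
    rw [hS, ENNReal.toReal_sum fun k _ => capTerm_ne_top ζ k]
    refine Finset.sum_congr rfl fun k _ => ?_
    rw [hcap, ENNReal.toReal_ofReal
      (mul_pos (inv_pos.2 (scale_pos k)) (inv_pos.2 (hM0 k))).le]
  -- These coefficients minimize ∑ c k² M k / `scale k` subject to the value at ζ being 2. A value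
  -- above 1 makes the modulus exceed 1 on a neighbourhood by continuity; the bound is 108 · 2²/S =
  -- 432/S.
  set c : ℕ → ℝ := fun k => 2 / S.toReal * (M k)⁻¹ with hc
  have hval : kernSum ζ c N ζ = 2 := by
    have h1 : kernSum ζ c N ζ =
        ((2 / S.toReal * ∑ k ∈ Finset.range N, (scale k)⁻¹ * (M k)⁻¹ : ℝ) : ℂ) := by
      rw [kernSum, Finset.mul_sum, Complex.ofReal_sum]
      refine Finset.sum_congr rfl fun k _ => ?_
      rw [kern_self, ← Complex.ofReal_mul]
      congr 1
      rw [hc]; ring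
    rw [h1, ← hsum, div_mul_cancel₀ _ hs.ne']
    norm_num
  have hnorm : normSq μ (fun ξ => kernSum ζ c N ξ) ≤ 432 / S := by
    refine (normSq_kernSum_le ζ c N).trans (le_of_eq ?_)
    have hterm : ∀ k, ENNReal.ofReal (c k ^ 2 / scale k) * radialMass μ ζ (scale k) =
        ENNReal.ofReal ((2 / S.toReal) ^ 2) * capTerm μ ζ k := fun k => by
      have := hM0 k
      have := scale_pos k
      rw [← hMM, hcap, ← ENNReal.ofReal_mul (by positivity), ← ENNReal.ofReal_mul (by positivity)]
      congr 1
      rw [hc]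
      field_simp
    simp only [hterm]
    rw [← Finset.mul_sum, ← hS, ← ENNReal.ofReal_toReal hStop,
      ENNReal.toReal_ofReal hs.le, ← ENNReal.ofReal_mul (by positivity),
      show (108 : ℝ≥0∞) = ENNReal.ofReal 108 by simp,
      show (432 : ℝ≥0∞) = ENNReal.ofReal 432 by simp, ← ENNReal.ofReal_mul (by norm_num),
      ← ENNReal.ofReal_div_of_pos hs]
    congr 1
    field_simp
    norm_num
  have hcont := continuous_kernSum ζ c N
  refine le_trans (sInf_le ?_) hnorm
  refine ⟨fun ξ => kernSum ζ c N ξ, ⟨?_, ?_⟩, ⟨{ξ : Circle | 1 < ‖kernSum ζ c N ξ‖}, ?_, ?_, ?_⟩,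
    rfl⟩
  · exact hcont.memLp_of_hasCompactSupport (HasCompactSupport.of_compactSpace _)
  · exact lt_of_le_of_lt (le_add_self.trans hnorm) (ENNReal.div_lt_top (by simp) hN)
  · exact isOpen_lt continuous_const hcont.norm
  · rintro _ rfl
    rw [mem_ofPred_eq, hval]
    norm_num
  · exact ae_of_all _ fun ξ hξ => le_of_lt hξ

theorem capacity_singleton_eq_zero {μ : Measure Disc} (hμ : RieszFinite μ) (ζ : Circle)
    (hS : ∑' k, capTerm μ ζ k = ∞) : capacity μ {ζ} = 0 := by
  by_contra h0
  have hlt : 432 / capacity μ {ζ} < ∑' k, capTerm μ ζ k := by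
    rw [hS]
    exact ENNReal.div_lt_top (by simp) h0
  rw [ENNReal.tsum_eq_iSup_nat, lt_iSup_iff] at hlt
  obtain ⟨N, hN⟩ := hlt
  have hN0 : ∑ k ∈ Finset.range N, capTerm μ ζ k ≠ 0 := (zero_le.trans_lt hN).ne'
  have hNtop : ∑ k ∈ Finset.range N, capTerm μ ζ k ≠ ∞ :=
    ENNReal.sum_ne_top.2 fun k _ => capTerm_ne_top ζ k
  have hle := capacity_singleton_le_div hμ ζ N hN0
  -- Finiteness of the capacity, needed to clear denominators in `ℝ≥0∞`, comes from the bound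
  -- itself.
  have htop : capacity μ {ζ} ≠ ∞ :=
    (hle.trans_lt (ENNReal.div_lt_top (by simp) hN0)).ne
  rw [ENNReal.le_div_iff_mul_le (Or.inl hN0) (Or.inl hNtop)] at hle
  rw [ENNReal.div_lt_iff (Or.inl h0) (Or.inl htop), mul_comm] at hN
  exact absurd hN (not_lt.2 hle)

end DirichletCapacity

end

theorem corollary4p3 (μ : MeasureTheory.Measure DirichletCapacity.Disc)
    (hμ : DirichletCapacity.RieszFinite μ) (ζ : Circle) :
    DirichletCapacity.capacity μ {ζ} = 0 ↔
      ∫⁻ r in Set.Ioo (0 : ℝ) 1,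
        (ENNReal.ofReal (1 - r) * DirichletCapacity.V μ ((r : ℂ) * (ζ : ℂ))
          + ENNReal.ofReal ((1 - r) ^ 2))⁻¹ = ∞ := by
  rw [DirichletCapacity.lintegral_inv_weight_eq_top_iff]
  refine ⟨fun h => ?_, DirichletCapacity.capacity_singleton_eq_zero hμ ζ⟩
  by_contra hS
  exact DirichletCapacity.capacity_singleton_ne_zero hμ ζ hS h
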